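/- **Definitions.** A *biframe* $\mathcal L=(L^+,L^-,L)$ consists of frames $L^+,L^-,L$ and injective frame maps $e^\pm:L^\pm\to L$ such that every element of $L$ is a join of elements $e^+(x^+)\wedge e^-(x^-)$. A biframe map $\mathcal L\to\mathcal M$ is a pair of frame maps $f^\pm:L^\pm\to M^\pm$ for which there is a (necessarily unique) frame map $f:L\to M$ with $f e^\pm=e^\pm f^\pm$. A congruence on a frame is an equivalence relation compatible with finite meets and arbitrary joins; congruences are ordered by inclusion and form a frame $\mathsf A(L)$. A relation $R$ on a frame generates the least congruence $C$ such that $[x]\le[y]$ modulo $C$ for all $(x,y)\in R$. Write $\nabla(a)=\{(x,y):x\vee a=y\vee a\}$ and $\Delta(a)=\{(x,y):x\wedge a=y\wedge a\}$. An element of $L$ is *finitary* if it is a finite join of elements $e^+(x^+)\wedge e^-(x^-)$; a congruence on $L$ is *finitary* if it is generated by a relation between finitary elements. The same definitions are used for the coproduct $L^+\oplus L^-$ with its coproduct injections; $\mathcal L$ is a *finitary biframe* if $L$ is isomorphic, compatibly with the maps from $L^\pm$, to $(L^+\oplus L^-)/C$ for a finitary congruence $C$. The *assembly* of $\mathcal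 L$ is the biframe $\mathsf A(\mathcal L)=(\mathsf A_{\nabla^+\Delta^-}(L),\mathsf A_{\nabla^-\Delta^+}(L),\mathsf A_{\mathsf{fin}}(L))$, where $\mathsf A_{\mathsf{fin}}(L)$ is the subframe of $\mathsf A(L)$ generated by all $\nabla(x)$, $x\in L$, and all $\Delta(s)$, $s$ finitary, and $\mathsf A_{\nabla^\pm\Delta^\mp}(L)$ is the subframe generated by all $\nabla(e^\pm x^\pm)$ and all $\Delta(e^\mp x^\mp)$; the map $\nabla:\mathcal L\to\mathsf A(\mathcal L)$ sends $x^\pm$ to $\nabla(e^\pm x^\pm)$. For $x^+\in L^+$ put ${\sim}x^+=\bigvee\{x^-\in L^-: e^+x^+\wedge e^-x^-=0\}$; it is a *bicomplement* of $x^+$ if $e^+x^+\vee e^-({\sim}x^+)=1$; similarly for $x^-\in L^-$. A biframe map $f:\mathcal L\to\mathcal M$ *provides bicomplements* if all $f^+(x^+)$ and all $f^-(x^-)$ have bicomplements in $\mathcal M$. For a congruence $C$ on $L$ let $\mathcal L/C=(L^+/C^+,L^- /C^-,L/C)$, where $C^\pm$ are the restrictions of $C$ along $e^\pm$. A *biquotient*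 of $\mathcal L$ is a quotient map $\mathcal L\to\mathcal L/C$ with $C$ finitary; $\mathsf S(\mathcal L)$ is the collection of biquotients ordered by $\mathcal L/C\le\mathcal L/D$ iff $D\subseteq C$. A *bispace* is a set $X$ with a positive and a negative topology $\Omega^\pm(X)$; its patch topology is generated by both, and a bisubspace is a subset with the two inherited topologies. A bihomeomorphism is a homeomorphism for both topologies. The Skula bispace $Sk(X)$ has the same points; its positive topology is generated by the positive opens and the negative closed sets, its negative topology by the negative opens and the positive closed sets. The bispectrum $\mathsf{bpt}(\mathcal L)$ is the set of biframe maps $f:\mathcal L\to\mathbf 2=(2,2,2)$, with positive opens $\{f:f^+(a^+)=1\}$, $a^+\in L^+$, and negative opens $\{f:f^-(a^-)=1\}$, $a^-\in L^-$. The finitary biframe of opens of $X$ is $\mathsf b\Omega_{\mathsf{fin}}(X)=(\Omega^+(X),\Omega^-(X),(\Omega^+(X)\oplus\Omega^-(X))/R)$, where $R$ consists of the pairs $(U^+\wedge U^-,V^+\vee V^-)$ such that $U^+\cap U^-\subseteq V^+\cup V^-$ in $X$. A bispace $X$ is *bisober* if the map $X\to\mathsf{bpt}(\mathsf b\Omega_{\mathsf{fin}}(X))$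 that sends $x$ to the pair of its neighbourhood maps ($U^\pm\mapsto 1$ iff $x\in U^\pm$) is a bihomeomorphism. **Theorem.** Let $\mathcal L$ be a finitary biframe. 1. $\mathsf A(\mathcal L)$ is a finitary biframe. 2. $\nabla:\mathcal L\to\mathsf A(\mathcal L)$ provides bicomplements, and for every biframe $\mathcal M$ and every biframe map $f:\mathcal L\to\mathcal M$ that provides bicomplements there is a unique biframe map $\tilde f:\mathsf A(\mathcal L)\to\mathcal M$ with $\tilde f\circ\nabla=f$. 3. The main component $\mathsf A_{\mathsf{fin}}(L)$ consists exactly of the finitary congruences on $L$; $\mathsf S(\mathcal L)$ is a coframe; and $C\mapsto(\mathcal L\to\mathcal L/C)$ is an anti-isomorphism from $\mathsf A_{\mathsf{fin}}(L)$ to $\mathsf S(\mathcal L)$. 4. There is a bihomeomorphism $\alpha:Sk(\mathsf{bpt}(\mathcal L))\to\mathsf{bpt}(\mathsf A(\mathcal L))$ with $\alpha(f)\circ\nabla=f$ for every point $f$ of $\mathcal L$, and a set $Y\subseteq\mathsf{bpt}(\mathcal L)$ has patch-closed image $\alpha[Y]$ in $\mathsf{bpt}(\mathsf A(\mathcal L))$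 if and only if the bisubspace $Y$ of $\mathsf{bpt}(\mathcal L)$ is bisober. -/

import Mathlib

universe u v w

/-! ## Frame congruences -/

/-- A congruence on a frame `L`: an equivalence relation that is compatible with finite meets
and arbitrary joins. (Compatibility with the empty meet is reflexivity.) -/
structure FrameCon (L : Type u) [Order.Frame L] extends Setoid L where
  inf_rel : ∀ {a b c d : L}, r a b → r c d → r (a ⊓ c) (b ⊓ d)
  iSup_rel : ∀ S : Set (L × L), (∀ p ∈ S, r p.1 p.2) → r (⨆ p ∈ S, p.1) (⨆ p ∈ S, p.2)

namespace FrameCon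

variable {L : Type u} [Order.Frame L]

theorem ext_rel {C D : FrameCon L} (h : ∀ a b, C.r a b ↔ D.r a b) : C = D := by
  obtain ⟨s, _, _⟩ := C
  obtain ⟨t, _, _⟩ := D
  have : s = t := Setoid.ext h
  subst this
  rfl

theorem rel_refl (C : FrameCon L) (a : L) : C.r a a := C.iseqv.refl a

theorem rel_symm (C : FrameCon L) {a b : L} (h : C.r a b) : C.r b a := C.iseqv.symm h

theorem rel_trans (C : FrameCon L) {a b c : L} (h : C.r a b) (h' : C.r b c) : C.r a c :=
  C.iseqv.trans h h'

theorem sup_rel (C : FrameCon L) {a b c d : L} (h : C.r a b) (h' : C.r c d) :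
    C.r (a ⊔ c) (b ⊔ d) := by
  have := C.iSup_rel {(a, b), (c, d)} (by
    rintro p (rfl | rfl)
    · exact h
    · exact h')
  rwa [iSup_pair, iSup_pair] at this

/-- Congruences are ordered by inclusion. -/
instance : PartialOrder (FrameCon L) where
  le C D := ∀ a b, C.r a b → D.r a b
  le_refl _ _ _ h := h
  le_trans _ _ _ h h' a b hab := h' a b (h a b hab)
  le_antisymm _ _ h h' := ext_rel fun a b => ⟨h a b, h' a b⟩

theorem le_def {C D : FrameCon L} : C ≤ D ↔ ∀ a b, C.r a b → D.r a b := Iff.rfl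

/-- The infimum of a set of congruences is their intersection. -/
instance : InfSet (FrameCon L) where
  sInf S :=
    { r := fun a b => ∀ C ∈ S, C.r a b
      iseqv := ⟨fun a C _ => C.rel_refl a, fun h C hC => C.rel_symm (h C hC),
        fun h h' C hC => C.rel_trans (h C hC) (h' C hC)⟩
      inf_rel := fun h h' C hC => C.inf_rel (h C hC) (h' C hC)
      iSup_rel := fun T hT C hC => C.iSup_rel T fun p hp => hT p hp C hC }

theorem sInf_rel {S : Set (FrameCon L)} {a b : L} :
    (sInf S).r a b ↔ ∀ C ∈ S, C.r a b := Iff.rfl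

instance : CompleteLattice (FrameCon L) :=
  completeLatticeOfInf (FrameCon L) fun _ =>
    ⟨fun _ hC _ _ h => h _ hC, fun _ hD a b h _ hC => hD hC a b h⟩

/-- The largest element of the congruence class of `x`. -/
def cl (C : FrameCon L) (x : L) : L := sSup {y | C.r x y}

theorem rel_cl (C : FrameCon L) (x : L) : C.r x (C.cl x) := by
  have h := C.iSup_rel ((fun y => (x, y)) '' {y | C.r x y}) (by
    rintro _ ⟨y, hy, rfl⟩
    exact hy)
  have h1 : (⨆ p ∈ (fun y => (x, y)) '' {y | C.r x y}, p.1) = x := by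
    rw [iSup_image]
    exact biSup_const ⟨x, C.rel_refl x⟩
  have h2 : (⨆ p ∈ (fun y => (x, y)) '' {y | C.r x y}, p.2) = C.cl x := by
    rw [iSup_image, cl, sSup_eq_iSup]
  rwa [h1, h2] at h

theorem le_cl (C : FrameCon L) {x y : L} (h : C.r x y) : y ≤ C.cl x := le_sSup h

theorem self_le_cl (C : FrameCon L) (x : L) : x ≤ C.cl x := C.le_cl (C.rel_refl x)

theorem cl_mono (C : FrameCon L) {x y : L} (h : x ≤ y) : C.cl x ≤ C.cl y := by
  have h1 : C.r y (C.cl x ⊔ y) := by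
    have := C.sup_rel (C.rel_cl x) (C.rel_refl y)
    rwa [sup_eq_right.2 h] at this
  exact le_sup_left.trans (C.le_cl h1)

theorem cl_eq_of_rel (C : FrameCon L) {x y : L} (h : C.r x y) : C.cl x = C.cl y :=
  le_antisymm (C.le_cl (C.rel_trans (C.rel_symm h) (C.rel_cl x)))
    (C.le_cl (C.rel_trans h (C.rel_cl y)))

theorem rel_iff_cl (C : FrameCon L) {x y : L} : C.r x y ↔ C.cl x = C.cl y := by
  refine ⟨C.cl_eq_of_rel, fun h => ?_⟩
  have h1 := C.rel_cl x
  rw [h] at h1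
  exact C.rel_trans h1 (C.rel_symm (C.rel_cl y))

theorem cl_inf (C : FrameCon L) (x y : L) : C.cl (x ⊓ y) = C.cl x ⊓ C.cl y :=
  le_antisymm (le_inf (C.cl_mono inf_le_left) (C.cl_mono inf_le_right))
    (C.le_cl (C.inf_rel (C.rel_cl x) (C.rel_cl y)))

/-- Congruences correspond to nuclei; this is only used to see that they form a frame. -/
def nucleusIso : FrameCon L ≃o Nucleus L where
  toFun C :=
    { toFun := C.cl
      map_inf' := C.cl_inf
      idempotent' := fun x => (C.cl_eq_of_rel (C.rel_cl x)).ge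
      le_apply' := C.self_le_cl }
  invFun n :=
    { r := fun a b => n a = n b
      iseqv := ⟨fun _ => rfl, fun h => h.symm, fun h h' => h.trans h'⟩
      inf_rel := fun h h' => by simp only [Nucleus.map_inf, h, h']
      iSup_rel := by
        have key : ∀ S : Set (L × L), (∀ p ∈ S, n p.1 = n p.2) →
            n (⨆ p ∈ S, p.1) ≤ n (⨆ p ∈ S, p.2) := by
          intro S hS
          rw [← n.idempotent (⨆ p ∈ S, p.2)]
          refine n.monotone (iSup₂_le fun p hp => ?_)
          exact n.le_apply.trans ((hS p hp).le.trans (n.monotone (le_iSup₂_of_le p hp le_rfl)))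
        intro S hS
        refine le_antisymm (key S hS) ?_
        have h2 := key (Prod.swap '' S) (by
          rintro _ ⟨p, hp, rfl⟩
          exact (hS p hp).symm)
        simpa only [iSup_image, Prod.fst_swap, Prod.snd_swap] using h2 }
  left_inv C := ext_rel fun _ _ => C.rel_iff_cl.symm
  right_inv n := by
    ext x
    refine le_antisymm (sSup_le fun y hy => ?_) (le_sSup ?_)
    · exact n.le_apply.trans (Eq.ge hy)
    · exact (n.idempotent x).symm
  map_rel_iff' := by
    intro C D
    constructor
    · intro h a b hab
      have h1 : b ≤ D.cl a := (C.le_cl hab).trans (h a)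
      have h2 : a ≤ D.cl b := (C.le_cl (C.rel_symm hab)).trans (h b)
      have h3 : ∀ {x y : L}, y ≤ D.cl x → D.cl y ≤ D.cl x := fun {x y} hxy =>
        (D.cl_mono hxy).trans (D.cl_eq_of_rel (D.rel_cl x)).ge
      exact D.rel_iff_cl.2 (le_antisymm (h3 h2) (h3 h1))
    · intro h x
      exact D.le_cl (h _ _ (C.rel_cl x))

/-- The congruences of a frame, ordered by inclusion, form a frame: the assembly of `L`. -/
instance : Order.Frame (FrameCon L) :=
  Order.Frame.ofMinimalAxioms
    { inf_sSup_le_iSup_inf := fun C S => by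
        rw [← nucleusIso.le_iff_le]
        simp only [map_inf, map_iSup, sSup_eq_iSup]
        rw [inf_iSup₂_eq] }

/-- The congruence generated by a relation `R`: the least congruence `C` such that
`[x] ≤ [y]` in `L / C` whenever `R x y`. -/
def gen (R : L → L → Prop) : FrameCon L :=
  sInf {C | ∀ x y, R x y → C.r (x ⊔ y) y}

theorem gen_rel {R : L → L → Prop} {x y : L} (h : R x y) : (gen R).r (x ⊔ y) y :=
  fun _ hC => hC x y h

theorem gen_le {R : L → L → Prop} {C : FrameCon L} (h : ∀ x y, R x y → C.r (x ⊔ y) y) :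
    gen R ≤ C := fun _ _ hab => hab C h

/-- The closed congruence `∇ a`, generated by the pair `(a, ⊥)`. -/
def nabla (a : L) : FrameCon L where
  r x y := x ⊔ a = y ⊔ a
  iseqv := ⟨fun _ => rfl, fun h => h.symm, fun h h' => h.trans h'⟩
  inf_rel h h' := by rw [sup_inf_right, sup_inf_right, h, h']
  iSup_rel S hS := by
    have key : ∀ T : Set (L × L), (∀ p ∈ T, p.1 ⊔ a = p.2 ⊔ a) →
        (⨆ p ∈ T, p.1) ⊔ a ≤ (⨆ p ∈ T, p.2) ⊔ a := by
      intro T hT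
      refine sup_le (iSup₂_le fun p hp => ?_) le_sup_right
      exact (le_sup_left.trans (hT p hp).le).trans
        (sup_le_sup_right (le_iSup₂ (f := fun (p : L × L) (_ : p ∈ T) => p.2) p hp) a)
    refine le_antisymm (key S hS) ?_
    have h2 := key (Prod.swap '' S) (by
      rintro _ ⟨p, hp, rfl⟩
      exact (hS p hp).symm)
    simpa only [iSup_image, Prod.fst_swap, Prod.snd_swap] using h2

/-- The open congruence `Δ a`, generated by the pair `(⊤, a)`. -/
def delta (a : L) : FrameCon L where
  r x y := x ⊓ a = y ⊓ a
  iseqv := ⟨fun _ => rfl, fun h => h.symm, fun h h' => h.trans h'⟩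
  inf_rel {x y z t} h h' := by
    rw [inf_inf_distrib_right x z a, inf_inf_distrib_right y t a, h, h']
  iSup_rel S hS := by
    rw [iSup₂_inf_eq, iSup₂_inf_eq]
    exact iSup_congr fun p => iSup_congr fun hp => hS p hp

/-- The pullback of a congruence along a frame map. -/
def comap {A : Type v} [Order.Frame A] (f : FrameHom A L) (C : FrameCon L) : FrameCon A where
  r x y := C.r (f x) (f y)
  iseqv := ⟨fun _ => C.rel_refl _, fun h => C.rel_symm h, fun h h' => C.rel_trans h h'⟩
  inf_rel h h' := by
    rw [map_inf, map_inf]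
    exact C.inf_rel h h'
  iSup_rel S hS := by
    have := C.iSup_rel (Prod.map f f '' S) (by
      rintro _ ⟨p, hp, rfl⟩
      exact hS p hp)
    rw [iSup_image, iSup_image] at this
    rw [map_iSup₂, map_iSup₂]
    exact this

/-- The kernel congruence of a frame map. -/
def ker {M : Type v} [Order.Frame M] (f : FrameHom L M) : FrameCon L where
  r x y := f x = f y
  iseqv := ⟨fun _ => rfl, fun h => h.symm, fun h h' => h.trans h'⟩
  inf_rel h h' := by rw [map_inf, map_inf, h, h']
  iSup_rel S hS := by
    rw [map_iSup₂, map_iSup₂]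
    exact iSup_congr fun p => iSup_congr fun hp => hS p hp

/-! ### Quotient frames -/

/-- The quotient `L / C` of a frame by a congruence. -/
def Quo (C : FrameCon L) : Type u := Quotient C.toSetoid

/-- The largest representative of a congruence class. -/
def rep (C : FrameCon L) : C.Quo → L :=
  Quotient.lift C.cl fun _ _ h => C.cl_eq_of_rel h

/-- The class of an element (as a plain function). -/
def cls (C : FrameCon L) (x : L) : C.Quo := Quotient.mk C.toSetoid x

theorem rep_cls (C : FrameCon L) (x : L) : C.rep (C.cls x) = C.cl x := rfl

theorem cls_surjective (C : FrameCon L) : Function.Surjective C.cls := Quotient.exists_rep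

theorem cls_eq (C : FrameCon L) {x y : L} : C.cls x = C.cls y ↔ C.r x y := Quotient.eq

theorem rep_injective (C : FrameCon L) : Function.Injective C.rep := by
  intro p q h
  obtain ⟨x, rfl⟩ := C.cls_surjective p
  obtain ⟨y, rfl⟩ := C.cls_surjective q
  exact C.cls_eq.2 (C.rel_iff_cl.2 h)

instance (C : FrameCon L) : PartialOrder C.Quo := PartialOrder.lift C.rep C.rep_injective

theorem cls_le_cls (C : FrameCon L) {x y : L} : C.cls x ≤ C.cls y ↔ C.cl x ≤ C.cl y := Iff.rfl

/-- Taking classes and taking largest representatives form a Galois insertion. -/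
def quoGI (C : FrameCon L) : GaloisInsertion C.cls C.rep where
  choice x _ := C.cls x
  gc x q := by
    obtain ⟨y, rfl⟩ := C.cls_surjective q
    refine ⟨fun h => (C.self_le_cl x).trans h, fun h => ?_⟩
    exact (C.cl_mono h).trans (C.cl_eq_of_rel (C.rel_cl y)).ge
  le_l_u q := by
    obtain ⟨y, rfl⟩ := C.cls_surjective q
    exact C.cl_mono (C.self_le_cl y)
  choice_eq _ _ := rfl

instance (C : FrameCon L) : CompleteLattice C.Quo := C.quoGI.liftCompleteLattice

theorem cls_inf (C : FrameCon L) (x y : L) : C.cls (x ⊓ y) = C.cls x ⊓ C.cls y := by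
  refine le_antisymm
    (le_inf (C.quoGI.gc.monotone_l inf_le_left) (C.quoGI.gc.monotone_l inf_le_right)) ?_
  obtain ⟨z, hz⟩ := C.cls_surjective (C.cls x ⊓ C.cls y)
  have h1 : C.cls z ≤ C.cls x := hz.trans_le inf_le_left
  have h2 : C.cls z ≤ C.cls y := hz.trans_le inf_le_right
  rw [← hz, cls_le_cls, cl_inf]
  exact le_inf h1 h2

instance (C : FrameCon L) : Order.Frame C.Quo :=
  Order.Frame.ofMinimalAxioms
    { inf_sSup_le_iSup_inf := fun q S => by
        obtain ⟨x, rfl⟩ := C.cls_surjective q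
        have h1 : sSup S = C.cls (sSup (C.rep '' S)) := C.quoGI.l_sSup_u_image S |>.symm
        rw [h1, ← cls_inf, sSup_image, inf_iSup₂_eq, C.quoGI.gc.l_iSup₂]
        refine iSup₂_mono fun p _ => ?_
        rw [cls_inf]
        exact inf_le_inf_left _ (C.quoGI.gc.l_u_le p) }

/-- The quotient map `L → L / C`. -/
def proj (C : FrameCon L) : FrameHom L C.Quo where
  toFun := C.cls
  map_inf' := C.cls_inf
  map_top' := top_unique (by
    obtain ⟨z, hz⟩ := C.cls_surjective ⊤
    rw [← hz]
    exact C.quoGI.gc.monotone_l le_top)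
  map_sSup' S := by rw [C.quoGI.gc.l_sSup, sSup_image]

theorem proj_surjective (C : FrameCon L) : Function.Surjective C.proj := C.cls_surjective

theorem proj_eq (C : FrameCon L) {x y : L} : C.proj x = C.proj y ↔ C.r x y := C.cls_eq

theorem proj_le_proj (C : FrameCon L) {x y : L} : C.proj x ≤ C.proj y ↔ C.r (x ⊔ y) y := by
  rw [← proj_eq, map_sup, sup_eq_right]

/-- A frame map that respects the congruence `C` factors through `L / C`. -/
def lift {M : Type v} [Order.Frame M] (C : FrameCon L) (f : FrameHom L M)
    (h : ∀ x y, C.r x y → f x = f y) : FrameHom C.Quo M where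
  toFun := Quotient.lift f h
  map_inf' p q := by
    obtain ⟨x, rfl⟩ := C.cls_surjective p
    obtain ⟨y, rfl⟩ := C.cls_surjective q
    rw [← cls_inf]
    exact map_inf f x y
  map_top' := by
    have : (⊤ : C.Quo) = C.cls ⊤ := (map_top C.proj).symm
    rw [this]
    exact map_top f
  map_sSup' S := by
    have h1 : sSup S = C.cls (sSup (C.rep '' S)) := C.quoGI.l_sSup_u_image S |>.symm
    rw [h1]
    change f (sSup (C.rep '' S)) = _
    rw [map_sSup, Set.image_image]
    congr 1
    refine Set.image_congr fun q _ => ?_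
    obtain ⟨x, rfl⟩ := C.cls_surjective q
    exact (h _ _ (C.rel_cl x)).symm

@[simp] theorem lift_proj {M : Type v} [Order.Frame M] (C : FrameCon L) (f : FrameHom L M)
    (h : ∀ x y, C.r x y → f x = f y) (x : L) : C.lift f h (C.proj x) = f x := rfl

end FrameCon

/-! ## Subframes -/

/-- A subframe: a subset closed under finite meets and arbitrary joins. -/
structure Subframe (L : Type u) [Order.Frame L] where
  carrier : Set L
  top_mem : ⊤ ∈ carrier
  inf_mem : ∀ {a b : L}, a ∈ carrier → b ∈ carrier → a ⊓ b ∈ carrier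
  sSup_mem : ∀ {S : Set L}, S ⊆ carrier → sSup S ∈ carrier

namespace Subframe

variable {L : Type u} [Order.Frame L]

instance : SetLike (Subframe L) L where
  coe := carrier
  coe_injective K K' h := by
    cases K
    cases K'
    congr

/-- The least subframe that contains a given set. -/
def closure (G : Set L) : Subframe L where
  carrier := {x | ∀ K : Subframe L, G ⊆ K → x ∈ K}
  top_mem K _ := K.top_mem
  inf_mem ha hb K hK := K.inf_mem (ha K hK) (hb K hK)
  sSup_mem hS K hK := K.sSup_mem fun _ hx => hS hx K hK

theorem subset_closure {G : Set L} {x : L} (hx : x ∈ G) : x ∈ closure G := fun _ hK => hK hx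

theorem mem_of_mem_closure {G : Set L} {K : Subframe L} (h : G ⊆ K) {x : L}
    (hx : x ∈ closure G) : x ∈ K := hx K h

instance (K : Subframe L) : PartialOrder K := inferInstanceAs (PartialOrder {x // x ∈ K})

instance (K : Subframe L) : SupSet K where
  sSup S := ⟨sSup (Subtype.val '' S), K.sSup_mem (by
    rintro _ ⟨x, _, rfl⟩
    exact x.2)⟩

instance (K : Subframe L) : CompleteLattice K where
  __ := completeLatticeOfSup K fun S =>
    ⟨fun _ hx => Subtype.coe_le_coe.1 (le_sSup (Set.mem_image_of_mem _ hx)),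
      fun _ hx => Subtype.coe_le_coe.1 (sSup_le (by
        rintro _ ⟨y, hy, rfl⟩
        exact hx hy))⟩
  top := ⟨⊤, K.top_mem⟩
  le_top _ := Subtype.coe_le_coe.1 le_top
  inf a b := ⟨a.1 ⊓ b.1, K.inf_mem a.2 b.2⟩
  inf_le_left _ _ := Subtype.coe_le_coe.1 inf_le_left
  inf_le_right _ _ := Subtype.coe_le_coe.1 inf_le_right
  le_inf _ _ _ h h' := Subtype.coe_le_coe.1 (le_inf h h')

theorem coe_sSup (K : Subframe L) (S : Set K) : ((sSup S : K) : L) = sSup (Subtype.val '' S) := rfl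

theorem coe_inf (K : Subframe L) (a b : K) : ((a ⊓ b : K) : L) = a.1 ⊓ b.1 := rfl

/-- The inclusion of a subframe in the ambient complete lattice. -/
def incl (K : Subframe L) : FrameHom K L where
  toFun := Subtype.val
  map_inf' _ _ := rfl
  map_top' := rfl
  map_sSup' _ := rfl

instance (K : Subframe L) : Order.Frame K :=
  Order.Frame.ofMinimalAxioms
    { inf_sSup_le_iSup_inf := fun a S => by
        change K.incl (a ⊓ sSup S) ≤ K.incl (⨆ b ∈ S, a ⊓ b)
        rw [map_inf, map_sSup, map_iSup₂, sSup_image, inf_iSup₂_eq]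
        exact le_of_eq (iSup_congr fun b => iSup_congr fun _ => (map_inf K.incl a b).symm) }

/-- The inclusion between two subframes. -/
def inclusion {K K' : Subframe L} (h : ∀ x ∈ K, x ∈ K') : FrameHom K K' where
  toFun x := ⟨x.1, h x.1 x.2⟩
  map_inf' _ _ := rfl
  map_top' := rfl
  map_sSup' S := by
    apply Subtype.ext
    rw [coe_sSup, coe_sSup, Set.image_image]

/-- A frame map with values in a subframe. -/
def codRestrict {A : Type v} [Order.Frame A] (K : Subframe L) (f : FrameHom A L)
    (h : ∀ a, f a ∈ K) : FrameHom A K where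
  toFun a := ⟨f a, h a⟩
  map_inf' a b := Subtype.ext (map_inf f a b)
  map_top' := Subtype.ext (map_top f)
  map_sSup' S := by
    apply Subtype.ext
    rw [coe_sSup, Set.image_image]
    exact map_sSup f S

end Subframe

/-! ## Frame coproducts -/

/-- The coproduct of two frames `A` and `B`: the lower subsets of `A × B` that are closed
under arbitrary joins in each coordinate, ordered by inclusion. -/
structure FrameCoprod (A : Type u) (B : Type v) [Order.Frame A] [Order.Frame B] where
  carrier : Set (A × B)
  lower : ∀ {a a' : A} {b b' : B}, a' ≤ a → b' ≤ b → (a, b) ∈ carrier → (a', b') ∈ carrier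
  sSup_left : ∀ (S : Set A) (b : B), (∀ a ∈ S, (a, b) ∈ carrier) → (sSup S, b) ∈ carrier
  sSup_right : ∀ (a : A) (S : Set B), (∀ b ∈ S, (a, b) ∈ carrier) → (a, sSup S) ∈ carrier

namespace FrameCoprod

variable {A : Type u} {B : Type v} [Order.Frame A] [Order.Frame B]

theorem carrier_injective :
    Function.Injective (carrier : FrameCoprod A B → Set (A × B)) := by
  intro U V h
  cases U
  cases V
  congr

instance : PartialOrder (FrameCoprod A B) := PartialOrder.lift carrier carrier_injective

theorem le_def {U V : FrameCoprod A B} : U ≤ V ↔ U.carrier ⊆ V.carrier := Iff.rfl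

instance : InfSet (FrameCoprod A B) where
  sInf S :=
    { carrier := {p | ∀ U ∈ S, p ∈ U.carrier}
      lower := fun ha hb h U hU => U.lower ha hb (h U hU)
      sSup_left := fun T b h U hU => U.sSup_left T b fun a ha => h a ha U hU
      sSup_right := fun a T h U hU => U.sSup_right a T fun b hb => h b hb U hU }

instance : CompleteLattice (FrameCoprod A B) where
  __ := completeLatticeOfInf (FrameCoprod A B) fun _ =>
    ⟨fun _ hU _ h => h _ hU, fun _ hV _ h _ hU => hV hU h⟩
  inf U V :=
    { carrier := U.carrier ∩ V.carrier
      lower := fun ha hb h => ⟨U.lower ha hb h.1, V.lower ha hb h.2⟩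
      sSup_left := fun T b h =>
        ⟨U.sSup_left T b fun a ha => (h a ha).1, V.sSup_left T b fun a ha => (h a ha).2⟩
      sSup_right := fun a T h =>
        ⟨U.sSup_right a T fun b hb => (h b hb).1, V.sSup_right a T fun b hb => (h b hb).2⟩ }
  inf_le_left _ _ := fun _ h => h.1
  inf_le_right _ _ := fun _ h => h.2
  le_inf _ _ _ h h' := fun _ hp => ⟨h hp, h' hp⟩
  top :=
    { carrier := Set.univ
      lower := fun _ _ _ => trivial
      sSup_left := fun _ _ _ => trivial
      sSup_right := fun _ _ _ => trivial }
  le_top _ := fun _ _ => trivial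

theorem mem_inf {U V : FrameCoprod A B} {p : A × B} :
    p ∈ (U ⊓ V).carrier ↔ p ∈ U.carrier ∧ p ∈ V.carrier := Iff.rfl

theorem mem_top {p : A × B} : p ∈ (⊤ : FrameCoprod A B).carrier := trivial

/-- The relative pseudocomplement. -/
def imp (U V : FrameCoprod A B) : FrameCoprod A B where
  carrier := {p | ∀ q ∈ U.carrier, (p.1 ⊓ q.1, p.2 ⊓ q.2) ∈ V.carrier}
  lower ha hb h q hq := V.lower (inf_le_inf_right _ ha) (inf_le_inf_right _ hb) (h q hq)
  sSup_left S b h q hq := by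
    have := V.sSup_left ((fun a => a ⊓ q.1) '' S) (b ⊓ q.2) (by
      rintro _ ⟨a, ha, rfl⟩
      exact h a ha q hq)
    rwa [sSup_image, ← sSup_inf_eq] at this
  sSup_right a S h q hq := by
    have := V.sSup_right (a ⊓ q.1) ((fun b => b ⊓ q.2) '' S) (by
      rintro _ ⟨b, hb, rfl⟩
      exact h b hb q hq)
    rwa [sSup_image, ← sSup_inf_eq] at this

theorem le_imp {U V W : FrameCoprod A B} : W ≤ imp U V ↔ U ⊓ W ≤ V := by
  constructor
  · intro h p hp
    have := h hp.2 p hp.1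
    rwa [inf_idem, inf_idem] at this
  · intro h p hp q hq
    exact h ⟨U.lower inf_le_right inf_le_right hq, W.lower inf_le_left inf_le_left hp⟩

instance : Order.Frame (FrameCoprod A B) :=
  Order.Frame.ofMinimalAxioms
    { inf_sSup_le_iSup_inf := fun U S => by
        rw [← le_imp]
        refine sSup_le fun V hV => ?_
        rw [le_imp]
        exact le_iSup₂_of_le V hV le_rfl }

/-- The underlying function of the coproduct injection `A → A ⊕ B`. -/
def inlFun (a : A) : FrameCoprod A B :=
    { carrier := {p | p.1 ≤ a ∨ p.2 = ⊥}
      lower := fun ha hb h => h.imp ha.trans fun h0 => le_bot_iff.1 (hb.trans h0.le)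
      sSup_left := fun S b h => by
        by_cases hb : b = ⊥
        · exact Or.inr hb
        · exact Or.inl (sSup_le fun x hx => (h x hx).resolve_right hb)
      sSup_right := fun x S h => by
        by_cases hx : x ≤ a
        · exact Or.inl hx
        · exact Or.inr (sSup_eq_bot.2 fun b hb => (h b hb).resolve_left hx) }

/-- The coproduct injection `A → A ⊕ B`. -/
def inl : FrameHom A (FrameCoprod A B) where
  toFun := inlFun
  map_inf' a a' := carrier_injective (by
    ext p
    simp only [mem_inf, inlFun, Set.mem_ofPred_eq, le_inf_iff]
    tauto)
  map_top' := carrier_injective (by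
    ext p
    exact ⟨fun _ => trivial, fun _ => Or.inl le_top⟩)
  map_sSup' S := by
    refine le_antisymm ?_ (sSup_le ?_)
    · set V := sSup (inlFun (A := A) (B := B) '' S) with hV
      rintro ⟨x, y⟩ (hx | hy)
      · refine V.lower hx le_rfl (V.sSup_left S y fun a ha => ?_)
        exact le_sSup (Set.mem_image_of_mem (inlFun (A := A) (B := B)) ha) (Or.inl le_rfl)
      · have h0 := V.sSup_right x ∅ (by simp)
        rw [sSup_empty] at h0
        have hy' : y = ⊥ := hy
        rwa [hy']
    · rintro _ ⟨a, ha, rfl⟩ p hp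
      exact hp.imp (fun h => h.trans (le_sSup ha)) id

/-- The underlying function of the coproduct injection `B → A ⊕ B`. -/
def inrFun (b : B) : FrameCoprod A B :=
    { carrier := {p | p.2 ≤ b ∨ p.1 = ⊥}
      lower := fun ha hb h => h.imp hb.trans fun h0 => le_bot_iff.1 (ha.trans h0.le)
      sSup_left := fun S y h => by
        by_cases hy : y ≤ b
        · exact Or.inl hy
        · exact Or.inr (sSup_eq_bot.2 fun a ha => (h a ha).resolve_left hy)
      sSup_right := fun a S h => by
        by_cases ha : a = ⊥
        · exact Or.inr ha
        · exact Or.inl (sSup_le fun x hx => (h x hx).resolve_right ha) }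

/-- The coproduct injection `B → A ⊕ B`. -/
def inr : FrameHom B (FrameCoprod A B) where
  toFun := inrFun
  map_inf' a a' := carrier_injective (by
    ext p
    simp only [mem_inf, inrFun, Set.mem_ofPred_eq, le_inf_iff]
    tauto)
  map_top' := carrier_injective (by
    ext p
    exact ⟨fun _ => trivial, fun _ => Or.inl le_top⟩)
  map_sSup' S := by
    refine le_antisymm ?_ (sSup_le ?_)
    · set V := sSup (inrFun (A := A) (B := B) '' S) with hV
      rintro ⟨x, y⟩ (hy | hx)
      · refine V.lower le_rfl hy (V.sSup_right x S fun b hb => ?_)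
        exact le_sSup (Set.mem_image_of_mem (inrFun (A := A) (B := B)) hb) (Or.inl le_rfl)
      · have h0 := V.sSup_left ∅ y (by simp)
        rw [sSup_empty] at h0
        have hx' : x = ⊥ := hx
        rwa [hx']
    · rintro _ ⟨a, ha, rfl⟩ p hp
      exact hp.imp (fun h => h.trans (le_sSup ha)) id

theorem mem_inl_inf_inr {a : A} {b : B} : (a, b) ∈ (inl a ⊓ inr b : FrameCoprod A B).carrier :=
  ⟨Or.inl le_rfl, Or.inl le_rfl⟩

theorem inl_inf_inr_le {a : A} {b : B} {U : FrameCoprod A B} (h : (a, b) ∈ U.carrier) :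
    inl a ⊓ inr b ≤ U := by
  rintro ⟨x, y⟩ ⟨h1, h2⟩
  have hbl : (⊥, y) ∈ U.carrier := by simpa using U.sSup_left ∅ y (by simp)
  have hbr : (x, ⊥) ∈ U.carrier := by simpa using U.sSup_right x ∅ (by simp)
  rcases h1 with h1 | h1
  · rcases h2 with h2 | h2
    · exact U.lower h1 h2 h
    · have h2' : x = ⊥ := h2
      rwa [h2']
  · have h1' : y = ⊥ := h1
    rwa [h1']

/-- Every element of the coproduct is a join of elements `a ⊓ b` with `a ∈ A`, `b ∈ B`. -/
theorem eq_sSup (U : FrameCoprod A B) :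
    U = sSup ((fun p : A × B => inl p.1 ⊓ inr p.2) '' U.carrier) := by
  refine le_antisymm (fun p hp => ?_) (sSup_le ?_)
  · exact le_sSup (Set.mem_image_of_mem (fun p : A × B => inl p.1 ⊓ inr p.2) hp) mem_inl_inf_inr
  · rintro _ ⟨p, hp, rfl⟩
    exact inl_inf_inr_le hp

/-- The copairing `A ⊕ B → M` of two frame maps. -/
def copair {M : Type w} [Order.Frame M] (f : FrameHom A M) (g : FrameHom B M) :
    FrameHom (FrameCoprod A B) M where
  toFun U := ⨆ p ∈ U.carrier, f p.1 ⊓ g p.2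
  map_inf' U V := by
    refine le_antisymm (iSup₂_le fun p hp => le_inf ?_ ?_) ?_
    · exact le_iSup₂_of_le p hp.1 le_rfl
    · exact le_iSup₂_of_le p hp.2 le_rfl
    · rw [iSup₂_inf_eq]
      refine iSup₂_le fun p hp => ?_
      rw [inf_iSup₂_eq]
      refine iSup₂_le fun q hq => ?_
      refine le_iSup₂_of_le (p.1 ⊓ q.1, p.2 ⊓ q.2)
        ⟨U.lower inf_le_left inf_le_left hp, V.lower inf_le_right inf_le_right hq⟩ ?_
      rw [map_inf, map_inf, inf_inf_inf_comm]
  map_top' := top_unique (le_iSup₂_of_le (⊤, ⊤) trivial (by simp))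
  map_sSup' S := by
    refine le_antisymm ?_ (sSup_le ?_)
    · let m : M := sSup ((fun U : FrameCoprod A B => ⨆ p ∈ U.carrier, f p.1 ⊓ g p.2) '' S)
      let W : FrameCoprod A B :=
        { carrier := {p | f p.1 ⊓ g p.2 ≤ m}
          lower := fun ha hb h =>
            (inf_le_inf (OrderHomClass.mono f ha) (OrderHomClass.mono g hb)).trans h
          sSup_left := fun T b h => by
            simp only [Set.mem_ofPred_eq, map_sSup, sSup_inf_eq, iSup_image] at *
            exact iSup₂_le h
          sSup_right := fun a T h => by
            simp only [Set.mem_ofPred_eq, map_sSup, inf_sSup_eq, iSup_image] at *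
            exact iSup₂_le h }
      have hW : sSup S ≤ W := sSup_le fun U hU p hp =>
        le_trans (le_iSup₂ (f := fun (p : A × B) (_ : p ∈ U.carrier) => f p.1 ⊓ g p.2) p hp)
          (le_sSup (Set.mem_image_of_mem _ hU))
      exact iSup₂_le fun p hp => hW hp
    · rintro _ ⟨U, hU, rfl⟩
      exact iSup₂_le fun p hp => le_iSup₂_of_le p (le_sSup hU hp) le_rfl

theorem copair_inl {M : Type w} [Order.Frame M] (f : FrameHom A M) (g : FrameHom B M) (a : A) :
    copair f g (inl a) = f a := by
  refine le_antisymm (iSup₂_le ?_) ?_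
  · rintro ⟨x, y⟩ (h | h)
    · exact inf_le_left.trans (OrderHomClass.mono f h)
    · have h' : y = ⊥ := h
      simp [h']
  · refine le_iSup₂_of_le (a, ⊤) (Or.inl le_rfl) (by simp)

theorem copair_inr {M : Type w} [Order.Frame M] (f : FrameHom A M) (g : FrameHom B M) (b : B) :
    copair f g (inr b) = g b := by
  refine le_antisymm (iSup₂_le ?_) ?_
  · rintro ⟨x, y⟩ (h | h)
    · exact inf_le_right.trans (OrderHomClass.mono g h)
    · have h' : x = ⊥ := h
      simp [h']
  · refine le_iSup₂_of_le (⊤, b) (Or.inl le_rfl) (by simp)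

end FrameCoprod

/-! ## The frame maps `∇` and `Δ` -/

namespace FrameCon

variable {L : Type u} [Order.Frame L]

theorem nabla_le {a : L} {C : FrameCon L} : nabla a ≤ C ↔ C.r a ⊥ := by
  refine ⟨fun h => h _ _ (show a ⊔ a = ⊥ ⊔ a by simp), fun h x y hxy => ?_⟩
  have h1 : ∀ z, C.r z (z ⊔ a) := fun z => by
    simpa using C.sup_rel (C.rel_refl z) (C.rel_symm h)
  have hxy' : x ⊔ a = y ⊔ a := hxy
  have h2 := h1 x
  rw [hxy'] at h2
  exact C.rel_trans h2 (C.rel_symm (h1 y))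

theorem delta_le {a : L} {C : FrameCon L} : delta a ≤ C ↔ C.r a ⊤ := by
  refine ⟨fun h => h _ _ (show a ⊓ a = ⊤ ⊓ a by simp), fun h x y hxy => ?_⟩
  have h1 : ∀ z, C.r z (z ⊓ a) := fun z => by
    simpa using C.inf_rel (C.rel_refl z) (C.rel_symm h)
  have hxy' : x ⊓ a = y ⊓ a := hxy
  have h2 := h1 x
  rw [hxy'] at h2
  exact C.rel_trans h2 (C.rel_symm (h1 y))

theorem rel_bot_of_le (C : FrameCon L) {a b : L} (hab : a ≤ b) (h : C.r b ⊥) : C.r a ⊥ := by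
  have := C.inf_rel (C.rel_refl a) h
  rwa [inf_eq_left.2 hab, inf_bot_eq] at this

theorem rel_top_of_le (C : FrameCon L) {a b : L} (hab : a ≤ b) (h : C.r a ⊤) : C.r b ⊤ := by
  have := C.sup_rel (C.rel_refl b) h
  rwa [sup_eq_left.2 hab, sup_top_eq] at this

/-- The closed congruences define a frame map `∇ : L → A(L)`. -/
def nablaHom (L : Type u) [Order.Frame L] : FrameHom L (FrameCon L) where
  toFun := nabla
  map_inf' a b := by
    refine le_antisymm (le_inf ?_ ?_) ?_
    · exact nabla_le.2 (rel_bot_of_le _ inf_le_left (nabla_le.1 le_rfl))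
    · exact nabla_le.2 (rel_bot_of_le _ inf_le_right (nabla_le.1 le_rfl))
    · intro x y h
      have h1 : x ⊔ a = y ⊔ a := (inf_le_left : nabla a ⊓ nabla b ≤ nabla a) x y h
      have h2 : x ⊔ b = y ⊔ b := (inf_le_right : nabla a ⊓ nabla b ≤ nabla b) x y h
      change x ⊔ a ⊓ b = y ⊔ a ⊓ b
      rw [sup_inf_left, sup_inf_left, h1, h2]
  map_top' := top_unique fun x y _ => show x ⊔ ⊤ = y ⊔ ⊤ by simp
  map_sSup' S := by
    refine eq_of_forall_ge_iff fun C => ?_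
    rw [sSup_image, iSup₂_le_iff, nabla_le]
    refine ⟨fun h a ha => nabla_le.2 (C.rel_bot_of_le (le_sSup ha) h), fun h => ?_⟩
    have := C.iSup_rel ((fun a => (a, ⊥)) '' S) (by
      rintro _ ⟨a, ha, rfl⟩
      exact nabla_le.1 (h a ha))
    rw [iSup_image, iSup_image] at this
    simpa [sSup_eq_iSup] using this

theorem delta_sup (a b : L) : delta (a ⊔ b) = delta a ⊓ delta b := by
  refine le_antisymm (le_inf ?_ ?_) ?_
  · exact delta_le.2 (rel_top_of_le _ le_sup_left (delta_le.1 le_rfl))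
  · exact delta_le.2 (rel_top_of_le _ le_sup_right (delta_le.1 le_rfl))
  · intro x y h
    have h1 : x ⊓ a = y ⊓ a := (inf_le_left : delta a ⊓ delta b ≤ delta a) x y h
    have h2 : x ⊓ b = y ⊓ b := (inf_le_right : delta a ⊓ delta b ≤ delta b) x y h
    change x ⊓ (a ⊔ b) = y ⊓ (a ⊔ b)
    rw [inf_sup_left, inf_sup_left, h1, h2]

theorem delta_bot : delta (⊥ : L) = ⊤ := top_unique fun x y _ => show x ⊓ ⊥ = y ⊓ ⊥ by simp

theorem delta_inf (a b : L) : delta (a ⊓ b) = delta a ⊔ delta b := by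
  refine eq_of_forall_ge_iff fun C => ?_
  rw [sup_le_iff, delta_le, delta_le, delta_le]
  refine ⟨fun h => ⟨C.rel_top_of_le inf_le_left h, C.rel_top_of_le inf_le_right h⟩, fun h => ?_⟩
  simpa using C.inf_rel h.1 h.2

theorem ker_proj (C : FrameCon L) : ker C.proj = C := ext_rel fun _ _ => C.proj_eq

end FrameCon

/-- The subframe of those elements that are joins of elements `p ⊓ n` with `p ∈ P`, `n ∈ N`. -/
def Subframe.joinsOf {M : Type u} [Order.Frame M] (P N : Subframe M) : Subframe M where
  carrier := {x | ∀ z, (∀ p ∈ P, ∀ n ∈ N, p ⊓ n ≤ x → p ⊓ n ≤ z) → x ≤ z}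
  top_mem z h := by simpa using h ⊤ P.top_mem ⊤ N.top_mem le_top
  inf_mem {x y} hx hy z h := by
    rw [← le_himp_iff]
    refine hx _ fun p hp n hn hpn => ?_
    rw [le_himp_iff, inf_comm, ← le_himp_iff]
    refine hy _ fun p' hp' n' hn' hpn' => ?_
    rw [le_himp_iff, inf_inf_inf_comm]
    refine h _ (P.inf_mem hp' hp) _ (N.inf_mem hn' hn) ?_
    rw [inf_inf_inf_comm]
    exact le_inf (inf_le_right.trans hpn) (inf_le_left.trans hpn')
  sSup_mem {S} hS z h := sSup_le fun x hx => hS hx z fun p hp n hn hpn =>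
    h p hp n hn (hpn.trans (le_sSup hx))

/-! ## Biframes -/

/-- A biframe: three frames with frame injections of the positive and the negative component
into the main component, such that every element of the main component is a join of meets
`e⁺ x ⊓ e⁻ y`. -/
structure Biframe where
  pos : Type u
  neg : Type u
  main : Type u
  [posFrame : Order.Frame pos]
  [negFrame : Order.Frame neg]
  [mainFrame : Order.Frame main]
  posIncl : FrameHom pos main
  negIncl : FrameHom neg main
  posIncl_injective : Function.Injective posIncl
  negIncl_injective : Function.Injective negIncl
  exists_eq_sSup : ∀ x : main, ∃ S : Set (pos × neg),
    x = sSup ((fun p : pos × neg => posIncl p.1 ⊓ negIncl p.2) '' S)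

attribute [instance] Biframe.posFrame Biframe.negFrame Biframe.mainFrame

/-- A morphism of biframes: a pair of frame maps that is induced by a frame map between the main
components. The latter is uniquely determined, see `BiframeHom.ext_pair`. -/
structure BiframeHom (L : Biframe.{u}) (M : Biframe.{v}) where
  pos : FrameHom L.pos M.pos
  neg : FrameHom L.neg M.neg
  main : FrameHom L.main M.main
  main_posIncl : ∀ a, main (L.posIncl a) = M.posIncl (pos a)
  main_negIncl : ∀ a, main (L.negIncl a) = M.negIncl (neg a)

theorem BiframeHom.ext_pair {L : Biframe.{u}} {M : Biframe.{v}} {f g : BiframeHom L M}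
    (hp : f.pos = g.pos) (hn : f.neg = g.neg) : f = g := by
  have hm : f.main = g.main := by
    ext x
    obtain ⟨S, rfl⟩ := L.exists_eq_sSup x
    simp only [map_sSup, Set.image_image, map_inf, f.main_posIncl, g.main_posIncl,
      f.main_negIncl, g.main_negIncl, hp, hn]
  cases f
  cases g
  simp only at hp hn hm
  subst hp hn hm
  rfl

/-- Composition of biframe morphisms. -/
def BiframeHom.comp {L : Biframe.{u}} {M : Biframe.{v}} {N : Biframe.{w}}
    (g : BiframeHom M N) (f : BiframeHom L M) : BiframeHom L N where
  pos := g.pos.comp f.pos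
  neg := g.neg.comp f.neg
  main := g.main.comp f.main
  main_posIncl a := by
    simp only [FrameHom.comp_apply, f.main_posIncl, g.main_posIncl]
  main_negIncl a := by
    simp only [FrameHom.comp_apply, f.main_negIncl, g.main_negIncl]

/-! ### Finitary elements, finitary congruences, finitary biframes -/

/-- The finitary elements of a frame `M` with respect to frame maps `f : A → M` and `g : B → M`:
the finite joins of elements `f a ⊓ g b`. -/
def finElts {A : Type u} {B : Type v} {M : Type w} [Order.Frame A] [Order.Frame B]
    [Order.Frame M] (f : FrameHom A M) (g : FrameHom B M) : Set M :=
  {x | ∃ s : Finset (A × B), x = s.sup fun p => f p.1 ⊓ g p.2}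

/-- A congruence is finitary if it is generated by a relation between finitary elements. -/
def FrameCon.IsFinitary {A : Type u} {B : Type v} {M : Type w} [Order.Frame A] [Order.Frame B]
    [Order.Frame M] (f : FrameHom A M) (g : FrameHom B M) (C : FrameCon M) : Prop :=
  ∃ R : M → M → Prop, (∀ x y, R x y → x ∈ finElts f g ∧ y ∈ finElts f g) ∧ C = FrameCon.gen R

namespace Biframe

/-- The set `fin(L)` of finitary elements of the main component. -/
def fin (L : Biframe.{u}) : Set L.main := finElts L.posIncl L.negIncl

/-- Finitary congruences on the main component of a biframe. -/
def IsFinitaryCon (L : Biframe.{u}) (C : FrameCon L.main) : Prop :=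
  C.IsFinitary L.posIncl L.negIncl

/-- A biframe is finitary if its main component is canonically isomorphic to
`(L⁺ ⊕ L⁻) / C` for a finitary congruence `C` on the coproduct. -/
def IsFinitary (L : Biframe.{u}) : Prop :=
  ∃ C : FrameCon (FrameCoprod L.pos L.neg), C.IsFinitary FrameCoprod.inl FrameCoprod.inr ∧
    ∃ i : C.Quo ≃o L.main, (∀ a, i (C.proj (FrameCoprod.inl a)) = L.posIncl a) ∧
      ∀ b, i (C.proj (FrameCoprod.inr b)) = L.negIncl b

/-! ### Biquotients -/

/-- The biframe quotient `L / C = (L⁺ / C⁺, L⁻ / C⁻, L / C)`, where `C⁺` and `C⁻` are the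
restrictions of `C` along the two inclusions. -/
def quot (L : Biframe.{u}) (C : FrameCon L.main) : Biframe.{u} where
  pos := (C.comap L.posIncl).Quo
  neg := (C.comap L.negIncl).Quo
  main := C.Quo
  posIncl := (C.comap L.posIncl).lift (C.proj.comp L.posIncl) fun _ _ h => C.proj_eq.2 h
  negIncl := (C.comap L.negIncl).lift (C.proj.comp L.negIncl) fun _ _ h => C.proj_eq.2 h
  posIncl_injective p q h := by
    obtain ⟨x, rfl⟩ := FrameCon.proj_surjective _ p
    obtain ⟨y, rfl⟩ := FrameCon.proj_surjective _ q
    exact (FrameCon.proj_eq _).2 (C.proj_eq.1 h)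
  negIncl_injective p q h := by
    obtain ⟨x, rfl⟩ := FrameCon.proj_surjective _ p
    obtain ⟨y, rfl⟩ := FrameCon.proj_surjective _ q
    exact (FrameCon.proj_eq _).2 (C.proj_eq.1 h)
  exists_eq_sSup q := by
    obtain ⟨x, rfl⟩ := C.proj_surjective q
    obtain ⟨S, rfl⟩ := L.exists_eq_sSup x
    refine ⟨(fun p => ((C.comap L.posIncl).proj p.1, (C.comap L.negIncl).proj p.2)) '' S, ?_⟩
    rw [map_sSup, Set.image_image, Set.image_image]
    refine congrArg sSup (Set.image_congr fun p _ => ?_)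
    rw [map_inf]
    rfl

/-- The quotient map `L → L / C`. -/
def quotMap (L : Biframe.{u}) (C : FrameCon L.main) : BiframeHom L (L.quot C) where
  pos := (C.comap L.posIncl).proj
  neg := (C.comap L.negIncl).proj
  main := C.proj
  main_posIncl _ := rfl
  main_negIncl _ := rfl

/-- The collection `S(L)` of biquotients of `L`: the quotient maps `L → L / C` for finitary
congruences `C` on the main component. -/
def Biquot (L : Biframe.{u}) : Type (u + 1) :=
  {Q : Σ M : Biframe.{u}, BiframeHom L M //
    ∃ C : FrameCon L.main, L.IsFinitaryCon C ∧ Q = ⟨L.quot C, L.quotMap C⟩}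

/-- The congruence on the main component that is induced by a biquotient. -/
def Biquot.con {L : Biframe.{u}} (Q : L.Biquot) : FrameCon L.main := FrameCon.ker Q.1.2.main

theorem Biquot.val_eq {L : Biframe.{u}} (Q : L.Biquot) :
    Q.1 = ⟨L.quot Q.con, L.quotMap Q.con⟩ := by
  obtain ⟨_, C, hC, rfl⟩ := Q
  have : FrameCon.ker (L.quotMap C).main = C := C.ker_proj
  change _ = (⟨L.quot (FrameCon.ker (L.quotMap C).main),
    L.quotMap (FrameCon.ker (L.quotMap C).main)⟩ : Σ M : Biframe.{u}, BiframeHom L M)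
  rw [this]

/-- Biquotients are ordered by `L / C ≤ L / D` if and only if `D ⊆ C`. -/
instance (L : Biframe.{u}) : PartialOrder L.Biquot where
  le Q Q' := Q'.con ≤ Q.con
  le_refl _ := le_refl _
  le_trans _ _ _ h h' := le_trans h' h
  le_antisymm Q Q' h h' := by
    have : Q.con = Q'.con := le_antisymm h' h
    exact Subtype.ext (by rw [Q.val_eq, Q'.val_eq, this])

/-! ### Bicomplements -/

/-- The bipseudocomplement of a positive element. -/
def bipseudoPos (L : Biframe.{u}) (x : L.pos) : L.neg :=
  sSup {y | L.posIncl x ⊓ L.negIncl y = ⊥}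

/-- The bipseudocomplement of a negative element. -/
def bipseudoNeg (L : Biframe.{u}) (y : L.neg) : L.pos :=
  sSup {x | L.posIncl x ⊓ L.negIncl y = ⊥}

/-- The bipseudocomplement of the positive element `x` is a bicomplement. -/
def HasBicomplPos (L : Biframe.{u}) (x : L.pos) : Prop :=
  L.posIncl x ⊔ L.negIncl (L.bipseudoPos x) = ⊤

/-- The bipseudocomplement of the negative element `y` is a bicomplement. -/
def HasBicomplNeg (L : Biframe.{u}) (y : L.neg) : Prop :=
  L.posIncl (L.bipseudoNeg y) ⊔ L.negIncl y = ⊤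

end Biframe

/-- A biframe map `f : L → M` provides bicomplements to all elements of `L⁺ ∪ L⁻`. -/
def BiframeHom.ProvidesBicompl {L : Biframe.{u}} {M : Biframe.{v}} (f : BiframeHom L M) : Prop :=
  (∀ x, M.HasBicomplPos (f.pos x)) ∧ ∀ y, M.HasBicomplNeg (f.neg y)

/-! ### The assembly -/

namespace Biframe

open FrameCon

/-- The finitary assembly: the subframe of the assembly of the main component that is generated
by the closed congruences `∇ x` and the open congruences `Δ s` with `s` finitary. -/
def finAssembly (L : Biframe.{u}) : Subframe (FrameCon L.main) :=
  Subframe.closure (Set.range nabla ∪ delta '' L.fin)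

/-- The subframe generated by the `∇ x⁺` and the `Δ x⁻`. -/
def posAssembly (L : Biframe.{u}) : Subframe (FrameCon L.main) :=
  Subframe.closure (Set.range (fun a => nabla (L.posIncl a)) ∪
    Set.range fun b => delta (L.negIncl b))

/-- The subframe generated by the `∇ x⁻` and the `Δ x⁺`. -/
def negAssembly (L : Biframe.{u}) : Subframe (FrameCon L.main) :=
  Subframe.closure (Set.range (fun b => nabla (L.negIncl b)) ∪
    Set.range fun a => delta (L.posIncl a))

theorem posIncl_mem_fin (L : Biframe.{u}) (a : L.pos) : L.posIncl a ∈ L.fin :=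
  ⟨{(a, ⊤)}, by simp⟩

theorem negIncl_mem_fin (L : Biframe.{u}) (b : L.neg) : L.negIncl b ∈ L.fin :=
  ⟨{(⊤, b)}, by simp⟩

theorem posAssembly_le (L : Biframe.{u}) : ∀ C ∈ L.posAssembly, C ∈ L.finAssembly := by
  intro C hC
  refine Subframe.mem_of_mem_closure ?_ hC
  rintro _ (⟨a, rfl⟩ | ⟨b, rfl⟩)
  · exact Subframe.subset_closure (Or.inl ⟨_, rfl⟩)
  · exact Subframe.subset_closure (Or.inr ⟨_, L.negIncl_mem_fin b, rfl⟩)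

theorem negAssembly_le (L : Biframe.{u}) : ∀ C ∈ L.negAssembly, C ∈ L.finAssembly := by
  intro C hC
  refine Subframe.mem_of_mem_closure ?_ hC
  rintro _ (⟨a, rfl⟩ | ⟨b, rfl⟩)
  · exact Subframe.subset_closure (Or.inl ⟨_, rfl⟩)
  · exact Subframe.subset_closure (Or.inr ⟨_, L.posIncl_mem_fin b, rfl⟩)

theorem finAssembly_le_joinsOf (L : Biframe.{u}) :
    ∀ C ∈ L.finAssembly, C ∈ Subframe.joinsOf L.posAssembly L.negAssembly := by
  intro C hC
  set K := Subframe.joinsOf L.posAssembly L.negAssembly with hK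
  have hmeet : ∀ P ∈ L.posAssembly, ∀ N ∈ L.negAssembly, P ⊓ N ∈ K :=
    fun P hP N hN z h => h P hP N hN le_rfl
  have hpos : ∀ P ∈ L.posAssembly, P ∈ K := fun P hP => by
    simpa using hmeet P hP ⊤ (Subframe.top_mem _)
  have hneg : ∀ N ∈ L.negAssembly, N ∈ K := fun N hN => by
    simpa using hmeet ⊤ (Subframe.top_mem _) N hN
  have hsup : ∀ {P N}, P ∈ K → N ∈ K → P ⊔ N ∈ K := fun {P N} hP hN => by
    rw [← sSup_pair]
    exact K.sSup_mem (by
      rintro _ (rfl | rfl)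
      · exact hP
      · exact hN)
  refine Subframe.mem_of_mem_closure ?_ hC
  rintro _ (⟨x, rfl⟩ | ⟨_, ⟨s, rfl⟩, rfl⟩)
  · obtain ⟨S, rfl⟩ := L.exists_eq_sSup x
    change nablaHom L.main _ ∈ K
    rw [map_sSup, Set.image_image]
    refine K.sSup_mem ?_
    rintro _ ⟨p, _, rfl⟩
    change nablaHom L.main _ ∈ K
    rw [map_inf]
    exact hmeet _ (Subframe.subset_closure (Or.inl ⟨p.1, rfl⟩)) _
      (Subframe.subset_closure (Or.inl ⟨p.2, rfl⟩))
  · classical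
    induction s using Finset.induction_on with
    | empty =>
      rw [Finset.sup_empty, delta_bot]
      exact K.top_mem
    | insert p s _ ih =>
      rw [Finset.sup_insert, delta_sup, delta_inf]
      refine K.inf_mem (hsup ?_ ?_) ih
      · exact hneg _ (Subframe.subset_closure (Or.inr ⟨p.1, rfl⟩))
      · exact hpos _ (Subframe.subset_closure (Or.inr ⟨p.2, rfl⟩))

/-- The assembly of a biframe, with the inclusions as the two frame injections. -/
def assembly (L : Biframe.{u}) : Biframe.{u} where
  pos := L.posAssembly
  neg := L.negAssembly
  main := L.finAssembly
  posIncl := Subframe.inclusion L.posAssembly_le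
  negIncl := Subframe.inclusion L.negAssembly_le
  posIncl_injective _ _ h := Subtype.ext (congrArg (fun C : L.finAssembly => C.1) h)
  negIncl_injective _ _ h := Subtype.ext (congrArg (fun C : L.finAssembly => C.1) h)
  exists_eq_sSup C := by
    refine ⟨{p | p.1.1 ⊓ p.2.1 ≤ C.1}, le_antisymm ?_ (sSup_le ?_)⟩
    · refine L.finAssembly_le_joinsOf C.1 C.2 _ fun P hP N hN h => ?_
      have : (⟨P ⊓ N, Subframe.inf_mem _ (L.posAssembly_le P hP) (L.negAssembly_le N hN)⟩ :
          L.finAssembly) ≤ _ :=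
        le_sSup (Set.mem_image_of_mem
          (fun p : L.posAssembly × L.negAssembly => Subframe.inclusion L.posAssembly_le p.1 ⊓
            Subframe.inclusion L.negAssembly_le p.2)
          (show ((⟨P, hP⟩, ⟨N, hN⟩) : L.posAssembly × L.negAssembly) ∈
            {p : L.posAssembly × L.negAssembly | p.1.1 ⊓ p.2.1 ≤ C.1} from h))
      exact this
    · rintro _ ⟨p, hp, rfl⟩
      exact hp

/-- The canonical biframe map `∇ : L → A(L)`, sending `x` to the closed congruence `∇ x`. -/
def toAssembly (L : Biframe.{u}) : BiframeHom L L.assembly where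
  pos := Subframe.codRestrict _ ((nablaHom L.main).comp L.posIncl) fun a =>
    Subframe.subset_closure (Or.inl ⟨a, rfl⟩)
  neg := Subframe.codRestrict _ ((nablaHom L.main).comp L.negIncl) fun b =>
    Subframe.subset_closure (Or.inl ⟨b, rfl⟩)
  main := Subframe.codRestrict _ (nablaHom L.main) fun x =>
    Subframe.subset_closure (Or.inl ⟨x, rfl⟩)
  main_posIncl _ := rfl
  main_negIncl _ := rfl

/-- The biframe `2 = (2, 2, 2)`, with the two-element frame of truth values. -/
def two : Biframe.{0} where
  pos := Prop
  neg := Prop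
  main := Prop
  posIncl := FrameHom.id Prop
  negIncl := FrameHom.id Prop
  posIncl_injective := Function.injective_id
  negIncl_injective := Function.injective_id
  exists_eq_sSup x := ⟨{(x, ⊤)}, by simp⟩

end Biframe

/-! ## Bispaces -/

/-- A bispace: a set with two topologies. -/
structure Bispace where
  carrier : Type u
  pos : TopologicalSpace carrier
  neg : TopologicalSpace carrier

namespace Bispace

/-- A subset `Y` of a bispace with the inherited bitopology. -/
def sub (X : Bispace.{u}) (Y : Set X.carrier) : Bispace.{u} where
  carrier := Y
  pos := X.pos.induced Subtype.val
  neg := X.neg.induced Subtype.val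

/-- Bihomeomorphisms: homeomorphisms for both topologies. -/
def IsBihomeo {X : Bispace.{u}} {Y : Bispace.{v}} (f : X.carrier → Y.carrier) : Prop :=
  @IsHomeomorph _ _ X.pos Y.pos f ∧ @IsHomeomorph _ _ X.neg Y.neg f

/-- The patch topology, generated by the positive and the negative opens. -/
abbrev patch (X : Bispace.{u}) : TopologicalSpace X.carrier :=
  TopologicalSpace.generateFrom ({U | X.pos.IsOpen U} ∪ {U | X.neg.IsOpen U})

/-- The Skula bispace: the positive topology is generated by the positive opens and the negative
closed sets, the negative topology by the negative opens and the positive closed sets. -/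
def skula (X : Bispace.{u}) : Bispace.{u} where
  carrier := X.carrier
  pos := TopologicalSpace.generateFrom ({U | X.pos.IsOpen U} ∪ {F | @IsClosed _ X.neg F})
  neg := TopologicalSpace.generateFrom ({U | X.neg.IsOpen U} ∪ {F | @IsClosed _ X.pos F})

/-- The frame of positive opens. -/
abbrev OpensPos (X : Bispace.{u}) : Type u := @TopologicalSpace.Opens X.carrier X.pos

/-- The frame of negative opens. -/
abbrev OpensNeg (X : Bispace.{u}) : Type u := @TopologicalSpace.Opens X.carrier X.neg

/-- The positive opens as subsets. -/
def posSet (X : Bispace.{u}) : FrameHom X.OpensPos (Set X.carrier) :=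
  @TopologicalSpace.Opens.frameHom X.carrier X.pos

/-- The negative opens as subsets. -/
def negSet (X : Bispace.{u}) : FrameHom X.OpensNeg (Set X.carrier) :=
  @TopologicalSpace.Opens.frameHom X.carrier X.neg

/-- The congruence on `Ω⁺(X) ⊕ Ω⁻(X)` generated by all pairs `(U⁺ ⊓ U⁻, V⁺ ⊔ V⁻)` such that
`U⁺ ∩ U⁻ ⊆ V⁺ ∪ V⁻` holds in `X`. -/
def finOpensCon (X : Bispace.{u}) : FrameCon (FrameCoprod X.OpensPos X.OpensNeg) :=
  FrameCon.gen fun x y => ∃ (U V : X.OpensPos) (U' V' : X.OpensNeg),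
    X.posSet U ∩ X.negSet U' ⊆ X.posSet V ∪ X.negSet V' ∧
      x = FrameCoprod.inl U ⊓ FrameCoprod.inr U' ∧ y = FrameCoprod.inl V ⊔ FrameCoprod.inr V'

theorem finOpensCon_le (X : Bispace.{u}) :
    X.finOpensCon ≤ FrameCon.ker (FrameCoprod.copair X.posSet X.negSet) := by
  refine FrameCon.gen_le ?_
  rintro _ _ ⟨U, V, U', V', h, rfl, rfl⟩
  change FrameCoprod.copair X.posSet X.negSet _ = FrameCoprod.copair X.posSet X.negSet _
  rw [map_sup, sup_eq_right, map_inf, map_sup, FrameCoprod.copair_inl, FrameCoprod.copair_inr,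
    FrameCoprod.copair_inl, FrameCoprod.copair_inr]
  exact h

/-- The finitary biframe of opens of a bispace. -/
def finOpens (X : Bispace.{u}) : Biframe.{u} where
  pos := X.OpensPos
  neg := X.OpensNeg
  main := X.finOpensCon.Quo
  posIncl := X.finOpensCon.proj.comp FrameCoprod.inl
  negIncl := X.finOpensCon.proj.comp FrameCoprod.inr
  posIncl_injective U V h := by
    have h1 : FrameCoprod.copair X.posSet X.negSet (FrameCoprod.inl U) =
      FrameCoprod.copair X.posSet X.negSet (FrameCoprod.inl V) :=
      X.finOpensCon_le _ _ (X.finOpensCon.proj_eq.1 h)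
    rw [FrameCoprod.copair_inl, FrameCoprod.copair_inl] at h1
    exact SetLike.coe_injective h1
  negIncl_injective U V h := by
    have h1 : FrameCoprod.copair X.posSet X.negSet (FrameCoprod.inr U) =
      FrameCoprod.copair X.posSet X.negSet (FrameCoprod.inr V) :=
      X.finOpensCon_le _ _ (X.finOpensCon.proj_eq.1 h)
    rw [FrameCoprod.copair_inr, FrameCoprod.copair_inr] at h1
    exact SetLike.coe_injective h1
  exists_eq_sSup q := by
    obtain ⟨U, rfl⟩ := X.finOpensCon.proj_surjective q
    refine ⟨U.carrier, ?_⟩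
    conv_lhs => rw [U.eq_sSup]
    rw [map_sSup, Set.image_image]
    refine congrArg sSup (Set.image_congr fun p _ => ?_)
    rw [map_inf]
    rfl

end Bispace

/-- The frame map `P(X) → 2` given by membership of a point. -/
def memHom {X : Type u} (x : X) : FrameHom (Set X) Prop where
  toFun S := x ∈ S
  map_inf' _ _ := rfl
  map_top' := rfl
  map_sSup' S := by
    rw [sSup_image]
    simp [Set.mem_sUnion]

/-- The topology whose open sets are the values of a frame map into a powerset. -/
abbrev rangeTopology {A : Type u} {P : Type v} [Order.Frame A] (φ : FrameHom A (Set P)) :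
    TopologicalSpace P where
  IsOpen U := ∃ a, U = φ a
  isOpen_univ := ⟨⊤, (map_top φ).symm⟩
  isOpen_inter := by
    rintro _ _ ⟨a, rfl⟩ ⟨b, rfl⟩
    exact ⟨a ⊓ b, (map_inf φ a b).symm⟩
  isOpen_sUnion S hS := by
    refine ⟨sSup (φ ⁻¹' S), ?_⟩
    rw [map_sSup, Set.image_preimage_eq_of_subset fun U hU => ?_]
    · rfl
    · obtain ⟨a, rfl⟩ := hS U hU
      exact ⟨a, rfl⟩

namespace Biframe

/-- The map `φ⁺`, sending a positive element `a` to the set of all points `f : L → 2` with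
`f⁺ a = 1`. -/
def posPoints (L : Biframe.{u}) : FrameHom L.pos (Set (BiframeHom L two)) where
  toFun a := {f | (f.pos a : Prop)}
  map_inf' a b := Set.ext fun f => by
    change f.pos (a ⊓ b) ↔ f.pos a ∧ f.pos b
    rw [map_inf]
    rfl
  map_top' := Set.ext fun f => by
    change f.pos ⊤ ↔ True
    rw [map_top]
    rfl
  map_sSup' S := Set.ext fun f => by
    rw [sSup_image]
    change f.pos (sSup S) ↔ f ∈ ⋃ a ∈ S, {f : BiframeHom L two | (f.pos a : Prop)}
    rw [map_sSup, Set.mem_iUnion₂]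
    exact ⟨fun ⟨_, ⟨a, ha, e⟩, h⟩ => ⟨a, ha, Eq.mpr e h⟩, fun ⟨a, ha, h⟩ => ⟨_, ⟨a, ha, rfl⟩, h⟩⟩

/-- The map `φ⁻`, sending a negative element `b` to the set of all points `f : L → 2` with
`f⁻ b = 1`. -/
def negPoints (L : Biframe.{u}) : FrameHom L.neg (Set (BiframeHom L two)) where
  toFun b := {f | (f.neg b : Prop)}
  map_inf' a b := Set.ext fun f => by
    change f.neg (a ⊓ b) ↔ f.neg a ∧ f.neg b
    rw [map_inf]
    rfl
  map_top' := Set.ext fun f => by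
    change f.neg ⊤ ↔ True
    rw [map_top]
    rfl
  map_sSup' S := Set.ext fun f => by
    rw [sSup_image]
    change f.neg (sSup S) ↔ f ∈ ⋃ a ∈ S, {f : BiframeHom L two | (f.neg a : Prop)}
    rw [map_sSup, Set.mem_iUnion₂]
    exact ⟨fun ⟨_, ⟨a, ha, e⟩, h⟩ => ⟨a, ha, Eq.mpr e h⟩, fun ⟨a, ha, h⟩ => ⟨_, ⟨a, ha, rfl⟩, h⟩⟩

/-- The bispectrum of a biframe: its points are the biframe maps to `2`, its positive opens are
the sets of all points `f` with `f⁺ a = 1`, for a positive element `a`, and similarly for its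
negative opens. -/
def bpt (L : Biframe.{u}) : Bispace.{u} where
  carrier := BiframeHom L two
  pos := rangeTopology L.posPoints
  neg := rangeTopology L.negPoints

end Biframe

namespace Bispace

/-- The canonical map `X → bpt(bΩ_fin(X))`, sending a point to its two neighbourhood maps. -/
def unit (X : Bispace.{u}) (x : X.carrier) : X.finOpens.bpt.carrier where
  pos := (memHom x).comp X.posSet
  neg := (memHom x).comp X.negSet
  main := X.finOpensCon.lift ((memHom x).comp (FrameCoprod.copair X.posSet X.negSet))
    fun _ _ h => congrArg (memHom x) (X.finOpensCon_le _ _ h)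
  main_posIncl U := congrArg (memHom x) (FrameCoprod.copair_inl X.posSet X.negSet U)
  main_negIncl U := congrArg (memHom x) (FrameCoprod.copair_inr X.posSet X.negSet U)

/-- A bispace is bisober if the canonical map to the bispectrum of its finitary biframe of opens
is a bihomeomorphism. -/
def IsBisober (X : Bispace.{u}) : Prop := IsBihomeo X.unit

end Bispace

/-!
The proof rests on the fact that the congruence generated by a pair `(x, y)` is `∇ x ⊓ Δ y`
(`FrameCon.nabla_inf_delta_le`). Hence a finitary congruence is the join of the `∇ x ⊓ Δ y` over
the pairs of finitary elements that it contains, and, since finitary elements are closed under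
finite meets and joins, the finitary congruences form a subframe, namely the finitary assembly
(`Biframe.mem_finAssembly_iff`). The statement about biquotients is a transport along the resulting
order isomorphism.

The universal property is that of the finitary assembly as a frame: a frame map `f` on the main
component under which all finitary elements acquire complements extends uniquely along `∇`. The
extension `Biframe.finExt` is given by `C ↦ ⨆ f x ⊓ (f s)ᶜ` over the pairs with `[x] ≤ [s]` modulo
`C`; it is left adjoint to `m ↦ f⁻¹(∇ m)` and hence preserves joins, while it preserves finite meets
by distributivity. Complements of positive elements being negative and vice versa, the extension
restricts to the components of the assembly (`Biframe.exists_assembly_extension`).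

The assembly is finitary because it is presented by the relations of the given biframe together
with relations, between finitary elements, saying that `∇ a` and `Δ a` are complements
(`Biframe.AssemblyRel`): the universal property supplies the inverse of the canonical map from the
presented frame to the assembly.

Since all elements of the biframe `2` have bicomplements, the universal property also identifies the
points of the assembly with the points `f` of the biframe, and `∇ a`, `Δ b` become an open set and
the complement of an open set, so the topologies are the Skula topologies. The adjunction shows that
the point belonging to `f` is false at `C` if and only if `C ≤ ker f`; as the patch-open sets are
the sets of points that are true at some `C` in the main component, the patch-closed sets are the
sets `{f | C ≤ ker f}` with `C` finitary (`Biframe.isClosed_patch_image_iff`). Such a set `Y` is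
bisober, because a point of its finitary biframe of opens respects every inclusion between finite
unions of sets `a ∩ b` that holds in `Y` (`Biframe.finite_union_transfer`), hence the finitary
relations that present the biframe and those that generate `C`. Conversely, if `Y` is bisober, then
`Y = {f | C ≤ ker f}` for the congruence `C` generated by all pairs `(a ⊓ b, c ⊔ d)` whose
inclusion holds in `Y` (`Biframe.mem_iff_of_isBisober`).
-/

/-! ### Subframes and frame maps -/

theorem Subframe.closure_induction {L : Type u} [Order.Frame L] {G : Set L}
    {p : closure G → Prop} (mem : ∀ x (hx : x ∈ G), p ⟨x, subset_closure hx⟩) (top : p ⊤)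
    (inf : ∀ x y, p x → p y → p (x ⊓ y)) (sSup : ∀ S : Set (closure G), (∀ x ∈ S, p x) → p (sSup S))
    (x : closure G) : p x := by
  let K : Subframe L :=
    { carrier := {x | ∃ h : x ∈ closure G, p ⟨x, h⟩}
      top_mem := ⟨_, top⟩
      inf_mem := fun ⟨_, ha⟩ ⟨_, hb⟩ => ⟨_, inf _ _ ha hb⟩
      sSup_mem := fun {S} hS => by
        have h := sSup (Subtype.val ⁻¹' S) fun x hx => (hS hx).2
        have e : Subtype.val '' (Subtype.val ⁻¹' S : Set (closure G)) = S :=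
          Set.image_preimage_eq_of_subset fun x hx => ⟨⟨x, (hS hx).1⟩, rfl⟩
        refine ⟨(closure G).sSup_mem fun x hx => (hS hx).1, ?_⟩
        convert h using 1
        exact Subtype.ext (by rw [coe_sSup, e]) }
  exact (mem_of_mem_closure (K := K) (fun x hx => ⟨_, mem x hx⟩) x.2).2

theorem Subframe.hom_ext_closure {L : Type u} {M : Type v} [Order.Frame L] [Order.Frame M]
    {G : Set L} {f g : FrameHom (closure G) M}
    (h : ∀ x (hx : x ∈ G), f ⟨x, subset_closure hx⟩ = g ⟨x, subset_closure hx⟩) : f = g := by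
  ext x
  refine closure_induction (p := fun x => f x = g x) h ?_ (fun x y hx hy => ?_) (fun S hS => ?_) x
  · rw [map_top, map_top]
  · rw [map_inf, map_inf, hx, hy]
  · rw [map_sSup, map_sSup, Set.image_congr hS]

theorem Subframe.isCompl_of_coe {L : Type u} [Order.Frame L] {K : Subframe L} {a b : K}
    (h : IsCompl (a : L) b) : IsCompl a b := by
  have hi : Function.Injective K.incl := Subtype.val_injective
  refine ⟨disjoint_iff.2 (hi ?_), codisjoint_iff.2 (hi ?_)⟩
  · rw [map_inf, map_bot]
    exact h.inf_eq_bot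
  · rw [map_sup, map_top]
    exact h.sup_eq_top

namespace FrameHom

variable {A : Type u} {B : Type v} {M : Type w} [Order.Frame A] [Order.Frame B] [Order.Frame M]

theorem exists_factor_of_injective {e : FrameHom A M} (he : Function.Injective e)
    (g : FrameHom B M) (h : ∀ b, ∃ a, e a = g b) : ∃ k : FrameHom B A, ∀ b, e (k b) = g b := by
  choose k hk using h
  refine ⟨⟨⟨⟨k, fun x y => he ?_⟩, he ?_⟩, fun S => he ?_⟩, hk⟩
  · rw [map_inf, hk, hk, hk, map_inf]
  · change e (k ⊤) = _
    rw [hk, map_top, map_top]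
  · change e (k _) = e (sSup (k '' S))
    rw [hk, map_sSup, map_sSup, Set.image_image]
    exact congrArg sSup (Set.image_congr fun b _ => (hk b).symm)

theorem exists_map_eq_top (e : FrameHom A M) (g : FrameHom B M) : ∃ a, e a = g ⊤ :=
  ⟨⊤, by rw [map_top, map_top]⟩

theorem exists_map_eq_inf {e : FrameHom A M} {g : FrameHom B M} {x y : B}
    (hx : ∃ a, e a = g x) (hy : ∃ a, e a = g y) : ∃ a, e a = g (x ⊓ y) := by
  obtain ⟨a, ha⟩ := hx
  obtain ⟨b, hb⟩ := hy
  exact ⟨a ⊓ b, by rw [map_inf, map_inf, ha, hb]⟩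

theorem exists_map_eq_sSup {e : FrameHom A M} {g : FrameHom B M} {S : Set B}
    (hS : ∀ x ∈ S, ∃ a, e a = g x) : ∃ a, e a = g (sSup S) := by
  refine ⟨sSup (e ⁻¹' (g '' S)), ?_⟩
  rw [map_sSup, map_sSup, Set.image_preimage_eq_of_subset]
  rintro _ ⟨x, hx, rfl⟩
  exact hS x hx

theorem exists_factor_of_surjective {e : FrameHom A B} (he : Function.Surjective e)
    (f : FrameHom A M) (h : ∀ x y, e x = e y → f x = f y) :
    ∃ k : FrameHom B M, ∀ a, k (e a) = f a := by
  choose s hs using he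
  have hk : ∀ a, f (s (e a)) = f a := fun a => h _ _ (hs _)
  refine ⟨⟨⟨⟨fun b => f (s b), fun x y => ?_⟩, ?_⟩, fun S => ?_⟩, hk⟩
  · rw [← map_inf]
    exact h _ _ (by rw [hs, map_inf, hs, hs])
  · change f (s ⊤) = ⊤
    rw [← map_top e, hk, map_top]
  · change f (s (sSup S)) = sSup ((fun b => f (s b)) '' S)
    rw [← Set.image_image f s, ← map_sSup]
    refine h _ _ ?_
    rw [hs, map_sSup, Set.image_image]
    simp only [hs, Set.image_id']

end FrameHom

/-- Frame maps out of a coproduct are determined by their restrictions along the injections. -/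
theorem FrameCoprod.hom_ext {A : Type u} {B : Type v} {M : Type w} [Order.Frame A] [Order.Frame B]
    [Order.Frame M] {f g : FrameHom (FrameCoprod A B) M} (hl : ∀ a, f (inl a) = g (inl a))
    (hr : ∀ b, f (inr b) = g (inr b)) : f = g := by
  ext U
  rw [U.eq_sSup, map_sSup, map_sSup, Set.image_image, Set.image_image]
  simp only [map_inf, hl, hr]

/-! ### Finitary elements -/

section FinElts

variable {A : Type u} {B : Type v} {M : Type w} [Order.Frame A] [Order.Frame B] [Order.Frame M]
  {f : FrameHom A M} {g : FrameHom B M}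

theorem map_inf_map_mem_finElts (a : A) (b : B) : f a ⊓ g b ∈ finElts f g := ⟨{(a, b)}, by simp⟩

theorem left_mem_finElts (a : A) : f a ∈ finElts f g := by
  simpa using map_inf_map_mem_finElts (f := f) (g := g) a ⊤

theorem right_mem_finElts (b : B) : g b ∈ finElts f g := by
  simpa using map_inf_map_mem_finElts (f := f) (g := g) ⊤ b

theorem bot_mem_finElts : (⊥ : M) ∈ finElts f g := ⟨∅, by simp⟩

theorem top_mem_finElts : (⊤ : M) ∈ finElts f g := by
  simpa using left_mem_finElts (f := f) (g := g) ⊤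

theorem sup_mem_finElts {x y : M} (hx : x ∈ finElts f g) (hy : y ∈ finElts f g) :
    x ⊔ y ∈ finElts f g := by
  classical
  obtain ⟨s, rfl⟩ := hx
  obtain ⟨t, rfl⟩ := hy
  exact ⟨s ∪ t, by rw [Finset.sup_union]⟩

theorem finElts_induction {p : M → Prop} (bot : p ⊥) (sup : ∀ x y, p x → p y → p (x ⊔ y))
    (inf : ∀ a b, p (f a ⊓ g b)) {x : M} (hx : x ∈ finElts f g) : p x := by
  obtain ⟨s, rfl⟩ := hx
  exact Finset.sup_induction bot (fun x hx y hy => sup x y hx hy) fun q _ => inf q.1 q.2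

theorem inf_mem_finElts {x y : M} (hx : x ∈ finElts f g) (hy : y ∈ finElts f g) :
    x ⊓ y ∈ finElts f g := by
  refine finElts_induction (p := fun x => x ⊓ y ∈ finElts f g) (by simp [bot_mem_finElts])
    (fun u v hu hv => ?_) (fun a b => ?_) hx
  · rw [inf_sup_right]
    exact sup_mem_finElts hu hv
  · refine finElts_induction (p := fun y => f a ⊓ g b ⊓ y ∈ finElts f g)
      (by simp [bot_mem_finElts]) (fun u v hu hv => ?_) (fun a' b' => ?_) hy
    · rw [inf_sup_left]
      exact sup_mem_finElts hu hv
    · rw [inf_inf_inf_comm, ← map_inf, ← map_inf]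
      exact map_inf_map_mem_finElts _ _

end FinElts

/-! ### Open and closed congruences -/

namespace FrameCon

variable {L : Type u} [Order.Frame L]

theorem inf_rel_iff {C D : FrameCon L} {x y : L} : (C ⊓ D).r x y ↔ C.r x y ∧ D.r x y :=
  ⟨fun h => ⟨(inf_le_left : C ⊓ D ≤ C) _ _ h, (inf_le_right : C ⊓ D ≤ D) _ _ h⟩, fun h => by
    rintro E (rfl | rfl)
    exacts [h.1, h.2]⟩

theorem gen_le_iff {R : L → L → Prop} {C : FrameCon L} :
    gen R ≤ C ↔ ∀ x y, R x y → C.r (x ⊔ y) y :=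
  ⟨fun h _ _ hxy => h _ _ (gen_rel hxy), gen_le⟩

/-- The congruence `∇ a ⊓ Δ b` is generated by the pair `(a, b)`. -/
theorem nabla_inf_delta_le {a b : L} {C : FrameCon L} :
    nabla a ⊓ delta b ≤ C ↔ C.r (a ⊔ b) b := by
  refine ⟨fun h => h _ _ (inf_rel_iff.2 ⟨?_, ?_⟩), fun h => ?_⟩
  · change a ⊔ b ⊔ a = b ⊔ a
    rw [sup_comm a b, sup_assoc, sup_idem]
  · change (a ⊔ b) ⊓ b = b ⊓ b
    simp
  -- `x = (x ⊓ y) ⊔ (x ⊓ (a ⊔ b))`, and modulo `C` the second joinand is `x ⊓ b ≤ y`.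
  · have key : ∀ x y : L, x ⊔ a = y ⊔ a → x ⊓ b = y ⊓ b → C.r x (x ⊓ y) := by
      intro x y hn hd
      have h1 : x ⊓ y ⊔ x ⊓ (a ⊔ b) = x := by
        rw [← inf_sup_left, inf_eq_left, ← sup_assoc, ← hn]
        exact le_sup_left.trans le_sup_left
      have h2 : x ⊓ y ⊔ x ⊓ b = x ⊓ y :=
        sup_eq_left.2 (le_inf inf_le_left (hd.le.trans inf_le_left))
      have := C.sup_rel (C.rel_refl (x ⊓ y)) (C.inf_rel (C.rel_refl x) h)
      rwa [h1, h2] at this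
    intro x y hxy
    obtain ⟨hn, hd⟩ := inf_rel_iff.1 hxy
    have h' := key y x hn.symm hd.symm
    rw [inf_comm] at h'
    exact C.rel_trans (key x y hn hd) (C.rel_symm h')

theorem isCompl_nabla_delta (a : L) : IsCompl (nabla a) (delta a) := by
  refine ⟨disjoint_iff_inf_le.2 (nabla_inf_delta_le.2 ?_), codisjoint_iff_le_sup.2 ?_⟩
  · rw [sup_idem]
  · have h1 := nabla_le.1 (le_sup_left : nabla a ≤ nabla a ⊔ delta a)
    have h2 := delta_le.1 (le_sup_right : delta a ≤ nabla a ⊔ delta a)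
    rw [← map_top (nablaHom L)]
    exact nabla_le.2 (rel_trans _ (rel_symm _ h2) h1)

theorem comap_nabla_bot {M : Type v} [Order.Frame M] (f : FrameHom L M) :
    comap f (nabla ⊥) = ker f := ext_rel fun a b => by
  change f a ⊔ ⊥ = f b ⊔ ⊥ ↔ f a = f b
  rw [sup_bot_eq, sup_bot_eq]

theorem nabla_rel_iff {a x y : L} : (nabla a).r (x ⊔ y) y ↔ x ≤ y ⊔ a := by
  change x ⊔ y ⊔ a = y ⊔ a ↔ _
  rw [sup_assoc, sup_eq_right]

/-- The congruence `gen R` is the join of the congruences `∇ x ⊓ Δ y` for `(x, y) ∈ R`. -/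
theorem gen_eq_sSup (R : L → L → Prop) :
    gen R = sSup {C | ∃ x y, R x y ∧ C = nabla x ⊓ delta y} := by
  refine eq_of_forall_ge_iff fun C => ?_
  rw [gen_le_iff, sSup_le_iff]
  refine ⟨?_, fun h x y hxy => nabla_inf_delta_le.1 (h _ ⟨x, y, hxy, rfl⟩)⟩
  rintro h _ ⟨x, y, hxy, rfl⟩
  exact nabla_inf_delta_le.2 (h x y hxy)

/-- A congruence is finitary if and only if it is generated by the pairs of finitary elements
that it contains. -/
theorem isFinitary_iff {A : Type v} {B : Type w} [Order.Frame A] [Order.Frame B]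
    {f : FrameHom A L} {g : FrameHom B L} {C : FrameCon L} :
    C.IsFinitary f g ↔ ∀ D : FrameCon L,
      (∀ x ∈ finElts f g, ∀ y ∈ finElts f g, C.r (x ⊔ y) y → D.r (x ⊔ y) y) → C ≤ D := by
  constructor
  · rintro ⟨R, hR, rfl⟩ D h
    exact gen_le fun x y hxy => h x (hR x y hxy).1 y (hR x y hxy).2 (gen_rel hxy)
  · intro h
    refine ⟨fun x y => x ∈ finElts f g ∧ y ∈ finElts f g ∧ C.r (x ⊔ y) y,
      fun x y hxy => ⟨hxy.1, hxy.2.1⟩, le_antisymm (h _ fun x hx y hy hxy => ?_) ?_⟩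
    · exact gen_rel (R := fun x y => x ∈ finElts f g ∧ y ∈ finElts f g ∧ C.r (x ⊔ y) y)
        ⟨hx, hy, hxy⟩
    · exact gen_le fun x y hxy => hxy.2.2

end FrameCon

/-! ### Finitary congruences on a biframe -/

namespace Biframe

open FrameCon

variable (L : Biframe.{u})

theorem eq_sSup_fin (x : L.main) : x = sSup {s | s ∈ L.fin ∧ s ≤ x} := by
  refine le_antisymm ?_ (sSup_le fun s hs => hs.2)
  obtain ⟨S, rfl⟩ := L.exists_eq_sSup x
  refine sSup_le_sSup ?_
  rintro _ ⟨p, hp, rfl⟩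
  exact ⟨map_inf_map_mem_finElts p.1 p.2, le_sSup ⟨p, hp, rfl⟩⟩

/-- The finitary congruences form a subframe of the assembly of the main component. -/
def finitaryCons : Subframe (FrameCon L.main) where
  carrier := {C | L.IsFinitaryCon C}
  top_mem := isFinitary_iff.2 fun D h => by
    rw [← map_top (nablaHom L.main)]
    refine nabla_le.2 ?_
    have := h ⊤ top_mem_finElts ⊥ bot_mem_finElts
      (by rw [← map_top (nablaHom L.main)]; exact nabla_rel_iff.2 le_sup_right)
    simpa using this
  -- Residuation reduces the claim to one generating pair `(x, y)` of `C` and one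
  -- `(x', y')` of `C'`; then `(x' ⊓ x, y' ⊔ y)` is a pair of finitary elements in `C ⊓ C'`.
  inf_mem {C C'} hC hC' := isFinitary_iff.2 fun D h => by
    rw [← le_himp_iff]
    refine isFinitary_iff.1 hC _ fun x hx y hy hxy => ?_
    rw [← nabla_inf_delta_le, le_himp_iff, inf_comm, ← le_himp_iff]
    refine isFinitary_iff.1 hC' _ fun x' hx' y' hy' hxy' => ?_
    have e : nabla x' ⊓ delta y' ⊓ (nabla x ⊓ delta y) =
        nabla (x' ⊓ x) ⊓ delta (y' ⊔ y) := by
      rw [delta_sup, inf_inf_inf_comm]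
      exact congrArg (· ⊓ _) (map_inf (nablaHom L.main) x' x).symm
    rw [← nabla_inf_delta_le, le_himp_iff, e, nabla_inf_delta_le]
    refine h _ (inf_mem_finElts hx' hx) _ (sup_mem_finElts hy' hy) ?_
    rw [← nabla_inf_delta_le] at hxy hxy' ⊢
    rw [← e]
    exact le_inf (inf_le_right.trans hxy) (inf_le_left.trans hxy')
  sSup_mem {S} hS := isFinitary_iff.2 fun D h => sSup_le fun C hC =>
    isFinitary_iff.1 (hS hC) D fun x hx y hy hxy => h x hx y hy (le_sSup hC _ _ hxy)

variable {L}

theorem mem_finAssembly_iff {C : FrameCon L.main} : C ∈ L.finAssembly ↔ L.IsFinitaryCon C := by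
  constructor
  · refine Subframe.mem_of_mem_closure (K := L.finitaryCons) ?_
    rintro _ (⟨x, rfl⟩ | ⟨s, hs, rfl⟩)
    · refine isFinitary_iff.2 fun D h => ?_
      have e : nabla x = sSup (nabla '' {s | s ∈ L.fin ∧ s ≤ x}) := by
        conv_lhs => rw [L.eq_sSup_fin x]
        exact map_sSup (nablaHom L.main) _
      rw [e, sSup_image]
      refine iSup₂_le fun s hs => nabla_le.2 ?_
      simpa using h s hs.1 ⊥ bot_mem_finElts (nabla_rel_iff.2 (hs.2.trans le_sup_right))
    · refine isFinitary_iff.2 fun D h => delta_le.2 ?_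
      have := h ⊤ top_mem_finElts s hs (show (⊤ ⊔ s) ⊓ s = s ⊓ s by simp)
      exact D.rel_symm (by simpa using this)
  · rintro ⟨R, hR, rfl⟩
    rw [gen_eq_sSup]
    refine Subframe.sSup_mem _ ?_
    rintro _ ⟨x, y, hxy, rfl⟩
    exact Subframe.inf_mem _ (Subframe.subset_closure (Or.inl ⟨x, rfl⟩))
      (Subframe.subset_closure (Or.inr ⟨y, (hR x y hxy).2, rfl⟩))

/-! ### The universal property of the finitary assembly -/

section FinExt

variable {M : Type v} [Order.Frame M] (f : FrameHom L.main M)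

/-- The value at `C` of the extension of `f` to the finitary assembly: the join of all differences
`f x ⊓ (f s)ᶜ`, where `s` is finitary and `[x] ≤ [s]` modulo `C`. -/
def finExtFun (C : FrameCon L.main) : M :=
  ⨆ (p : L.main × L.main) (_ : p.2 ∈ L.fin ∧ C.r (p.1 ⊔ p.2) p.2), f p.1 ⊓ (f p.2)ᶜ

variable {f}

/-- `finExtFun f` is left adjoint to `m ↦ f⁻¹(∇ m)` on finitary congruences. -/
theorem finExtFun_le_iff (hf : ∀ s ∈ L.fin, f s ⊔ (f s)ᶜ = ⊤) {C : FrameCon L.main}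
    (hC : C ∈ L.finAssembly) {m : M} : finExtFun f C ≤ m ↔ C ≤ comap f (nabla m) := by
  have hD : ∀ x y, (comap f (nabla m)).r (x ⊔ y) y ↔ f x ≤ f y ⊔ m := fun x y => by
    rw [← nabla_rel_iff, ← map_sup]
    rfl
  constructor
  · refine fun h => isFinitary_iff.1 (mem_finAssembly_iff.1 hC) _ fun x hx y hy hxy => ?_
    rw [hD]
    have h1 : f x ⊓ (f y)ᶜ ≤ m := (le_iSup₂_of_le (x, y) ⟨hy, hxy⟩ le_rfl).trans h
    rw [← inf_top_eq (f x), ← hf y hy, inf_sup_left]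
    exact sup_le_sup inf_le_right h1
  · refine fun h => iSup₂_le fun p hp => ?_
    have h1 := (hD _ _).1 (h _ _ hp.2)
    calc f p.1 ⊓ (f p.2)ᶜ ≤ (f p.2 ⊔ m) ⊓ (f p.2)ᶜ := inf_le_inf_right _ h1
      _ = m ⊓ (f p.2)ᶜ := by rw [inf_sup_right, inf_compl_self, bot_sup_eq]
      _ ≤ m := inf_le_left

variable (f) in
/-- A frame map `f` that sends finitary elements to complemented elements extends to the finitary
assembly. Joins are preserved by adjointness, finite meets by distributivity. -/
def finExt (hf : ∀ s ∈ L.fin, f s ⊔ (f s)ᶜ = ⊤) :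
    FrameHom L.assembly.main M where
  toFun C := finExtFun f C.1
  map_inf' C D := by
    refine le_antisymm (le_inf (iSup₂_le fun p hp => ?_) (iSup₂_le fun p hp => ?_)) ?_
    · exact le_iSup₂_of_le p ⟨hp.1, (inf_rel_iff.1 hp.2).1⟩ le_rfl
    · exact le_iSup₂_of_le p ⟨hp.1, (inf_rel_iff.1 hp.2).2⟩ le_rfl
    · unfold finExtFun
      rw [iSup₂_inf_eq]
      refine iSup₂_le fun p hp => ?_
      rw [inf_iSup₂_eq]
      refine iSup₂_le fun q hq => le_iSup₂_of_le (p.1 ⊓ q.1, p.2 ⊔ q.2)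
        ⟨sup_mem_finElts hp.1 hq.1, ?_⟩ ?_
      · rw [← nabla_inf_delta_le, delta_sup]
        have e : nabla (p.1 ⊓ q.1) = nabla p.1 ⊓ nabla q.1 := map_inf (nablaHom L.main) _ _
        rw [e, inf_inf_inf_comm]
        exact inf_le_inf (nabla_inf_delta_le.2 hp.2) (nabla_inf_delta_le.2 hq.2)
      · rw [map_inf, map_sup, compl_sup, inf_inf_inf_comm]
  map_top' := top_unique (le_iSup₂_of_le (⊤, ⊥) ⟨bot_mem_finElts, by
    change (⊤ : FrameCon L.main).r _ _
    rw [← map_top (nablaHom L.main)]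
    exact nabla_rel_iff.2 le_sup_right⟩ (by simp))
  map_sSup' (S : Set L.finAssembly) := by
    refine eq_of_forall_ge_iff fun m => ?_
    change finExtFun f (sSup (Subtype.val '' S)) ≤ m ↔
      sSup ((fun C : L.finAssembly => finExtFun f C.1) '' S) ≤ m
    rw [finExtFun_le_iff hf (C := sSup (Subtype.val '' S)) (sSup S).2, sSup_image, sSup_image,
      iSup₂_le_iff, iSup₂_le_iff]
    exact forall₂_congr fun C _ => (finExtFun_le_iff hf C.2).symm

theorem finExt_nabla (hf : ∀ s ∈ L.fin, f s ⊔ (f s)ᶜ = ⊤) (x : L.main) :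
    finExt f hf (L.toAssembly.main x) = f x := by
  refine eq_of_forall_ge_iff fun m => ?_
  change finExtFun f (nabla x) ≤ m ↔ _
  rw [finExtFun_le_iff hf (C := nabla x) (L.toAssembly.main x).2, nabla_le]
  change f x ⊔ m = f ⊥ ⊔ m ↔ _
  rw [map_bot, bot_sup_eq, sup_eq_right]

theorem finExt_le_iff (hf : ∀ s ∈ L.fin, f s ⊔ (f s)ᶜ = ⊤) {C : L.assembly.main} {m : M} :
    finExt f hf C ≤ m ↔ C.1 ≤ comap f (nabla m) := finExtFun_le_iff hf C.2

end FinExt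

end Biframe

/-! ### Bicomplements -/

namespace Biframe

open FrameCon

theorem isCompl_bipseudoPos {M : Biframe.{u}} {x : M.pos} (h : M.HasBicomplPos x) :
    IsCompl (M.posIncl x) (M.negIncl (M.bipseudoPos x)) := by
  refine ⟨disjoint_iff.2 ?_, codisjoint_iff.2 h⟩
  rw [bipseudoPos, map_sSup, inf_sSup_eq, iSup_image]
  exact le_bot_iff.1 (iSup₂_le fun y hy => le_of_eq hy)

theorem isCompl_bipseudoNeg {M : Biframe.{u}} {y : M.neg} (h : M.HasBicomplNeg y) :
    IsCompl (M.posIncl (M.bipseudoNeg y)) (M.negIncl y) := by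
  refine ⟨disjoint_iff.2 ?_, codisjoint_iff.2 h⟩
  rw [bipseudoNeg, map_sSup, sSup_inf_eq, iSup_image]
  exact le_bot_iff.1 (iSup₂_le fun y hy => le_of_eq hy)

theorem hasBicomplPos_of_isCompl {M : Biframe.{u}} {x : M.pos} {y : M.neg}
    (h : IsCompl (M.posIncl x) (M.negIncl y)) : M.HasBicomplPos x :=
  top_unique (h.sup_eq_top.ge.trans
    (sup_le_sup_left (OrderHomClass.mono M.negIncl (le_sSup h.inf_eq_bot)) _))

theorem hasBicomplNeg_of_isCompl {M : Biframe.{u}} {x : M.pos} {y : M.neg}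
    (h : IsCompl (M.posIncl x) (M.negIncl y)) : M.HasBicomplNeg y :=
  top_unique (h.sup_eq_top.ge.trans
    (sup_le_sup_right (OrderHomClass.mono M.posIncl (le_sSup h.inf_eq_bot)) _))

variable {L : Biframe.{u}}

/-- The open congruence `Δ s` of a finitary element, as an element of the assembly. -/
def deltaFin {s : L.main} (hs : s ∈ L.fin) : L.assembly.main :=
  (⟨delta s, Subframe.subset_closure (Or.inr ⟨s, hs, rfl⟩)⟩ : L.finAssembly)

/-- The open congruence `Δ a` as a negative element of the assembly. -/
def deltaPos (a : L.pos) : L.assembly.neg :=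
  (⟨delta (L.posIncl a), Subframe.subset_closure (Or.inr ⟨a, rfl⟩)⟩ : L.negAssembly)

/-- The open congruence `Δ b` as a positive element of the assembly. -/
def deltaNeg (b : L.neg) : L.assembly.pos :=
  (⟨delta (L.negIncl b), Subframe.subset_closure (Or.inr ⟨b, rfl⟩)⟩ : L.posAssembly)

theorem isCompl_deltaFin {s : L.main} (hs : s ∈ L.fin) :
    IsCompl (L.toAssembly.main s) (deltaFin hs) :=
  Subframe.isCompl_of_coe (K := L.finAssembly) (isCompl_nabla_delta s)

theorem isCompl_deltaPos (a : L.pos) :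
    IsCompl (L.assembly.posIncl (L.toAssembly.pos a)) (L.assembly.negIncl (deltaPos a)) :=
  isCompl_deltaFin (L.posIncl_mem_fin a)

theorem isCompl_deltaNeg (b : L.neg) :
    IsCompl (L.assembly.posIncl (deltaNeg b)) (L.assembly.negIncl (L.toAssembly.neg b)) :=
  (isCompl_deltaFin (L.negIncl_mem_fin b)).symm

theorem toAssembly_providesBicompl : L.toAssembly.ProvidesBicompl :=
  ⟨fun a => hasBicomplPos_of_isCompl (isCompl_deltaPos a),
    fun b => hasBicomplNeg_of_isCompl (isCompl_deltaNeg b)⟩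

section Extension

variable {M : Type v} [Order.Frame M]

/-- Complements of positive and negative elements give complements of all finitary elements. -/
theorem sup_compl_of_mem_fin {f : FrameHom L.main M}
    (hp : ∀ a, IsComplemented (f (L.posIncl a))) (hn : ∀ b, IsComplemented (f (L.negIncl b)))
    {s : L.main} (hs : s ∈ L.fin) : f s ⊔ (f s)ᶜ = ⊤ := by
  have h : IsComplemented (f s) := by
    refine finElts_induction (p := fun s => IsComplemented (f s)) ?_ (fun x y hx hy => ?_)
      (fun a b => ?_) hs
    · rw [map_bot]
      exact isComplemented_bot
    · rw [map_sup]
      exact hx.sup hy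
    · rw [map_inf]
      exact (hp a).inf (hn b)
  obtain ⟨c, hc⟩ := h
  rw [hc.compl_eq]
  exact hc.sup_eq_top

theorem assembly_pos_induction {p : L.assembly.pos → Prop} (nabla : ∀ a, p (L.toAssembly.pos a))
    (delta : ∀ b, p (deltaNeg b)) (top : p ⊤) (inf : ∀ P Q, p P → p Q → p (P ⊓ Q))
    (sSup : ∀ S : Set L.assembly.pos, (∀ P ∈ S, p P) → p (sSup S)) (P : L.assembly.pos) : p P := by
  refine Subframe.closure_induction (p := p) ?_ top inf sSup P
  rintro _ (⟨a, rfl⟩ | ⟨b, rfl⟩)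
  exacts [nabla a, delta b]

theorem assembly_neg_induction {p : L.assembly.neg → Prop} (nabla : ∀ b, p (L.toAssembly.neg b))
    (delta : ∀ a, p (deltaPos a)) (top : p ⊤) (inf : ∀ P Q, p P → p Q → p (P ⊓ Q))
    (sSup : ∀ S : Set L.assembly.neg, (∀ P ∈ S, p P) → p (sSup S)) (P : L.assembly.neg) : p P := by
  refine Subframe.closure_induction (p := p) ?_ top inf sSup P
  rintro _ (⟨a, rfl⟩ | ⟨b, rfl⟩)
  exacts [nabla a, delta b]

/-- A frame map on the finitary assembly is determined by its values on the `∇ x`, since it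
preserves complements. -/
theorem assembly_main_hom_ext {g g' : FrameHom L.assembly.main M}
    (h : ∀ x, g (L.toAssembly.main x) = g' (L.toAssembly.main x)) : g = g' := by
  refine Subframe.hom_ext_closure ?_
  rintro _ (⟨x, rfl⟩ | ⟨s, hs, rfl⟩)
  · exact h x
  · have h1 := (isCompl_deltaFin hs).map g
    have h2 := (isCompl_deltaFin hs).map g'
    rw [← h s] at h2
    exact h1.right_unique h2

theorem assembly_pos_hom_ext {g g' : FrameHom L.assembly.pos M}
    (h : ∀ a, g (L.toAssembly.pos a) = g' (L.toAssembly.pos a))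
    (h' : ∀ b, g (deltaNeg b) = g' (deltaNeg b)) : g = g' := by
  ext P
  refine assembly_pos_induction (p := fun P => g P = g' P) h h' ?_ (fun x y hx hy => ?_)
    (fun S hS => ?_) P
  · rw [map_top, map_top]
  · rw [map_inf, map_inf, hx, hy]
  · rw [map_sSup, map_sSup, Set.image_congr hS]

theorem assembly_neg_hom_ext {g g' : FrameHom L.assembly.neg M}
    (h : ∀ b, g (L.toAssembly.neg b) = g' (L.toAssembly.neg b))
    (h' : ∀ a, g (deltaPos a) = g' (deltaPos a)) : g = g' := by
  ext P
  refine assembly_neg_induction (p := fun P => g P = g' P) h h' ?_ (fun x y hx hy => ?_)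
    (fun S hS => ?_) P
  · rw [map_top, map_top]
  · rw [map_inf, map_inf, hx, hy]
  · rw [map_sSup, map_sSup, Set.image_congr hS]

theorem main_hom_ext {g g' : FrameHom L.main M} (hp : ∀ a, g (L.posIncl a) = g' (L.posIncl a))
    (hn : ∀ b, g (L.negIncl b) = g' (L.negIncl b)) : g = g' := by
  ext x
  obtain ⟨S, rfl⟩ := L.exists_eq_sSup x
  simp only [map_sSup, Set.image_image, map_inf, hp, hn]

end Extension

theorem assembly_hom_ext {M : Biframe.{v}} {g g' : BiframeHom L.assembly M}
    (h : g.comp L.toAssembly = g'.comp L.toAssembly) : g = g' := by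
  have hm : g.main = g'.main := assembly_main_hom_ext fun x => by
    have := congrArg (fun k : BiframeHom L M => k.main x) h
    exact this
  refine BiframeHom.ext_pair ?_ ?_
  · ext P
    exact M.posIncl_injective (by rw [← g.main_posIncl, ← g'.main_posIncl, hm])
  · ext N
    exact M.negIncl_injective (by rw [← g.main_negIncl, ← g'.main_negIncl, hm])

theorem sup_compl_of_providesBicompl {M : Biframe.{v}} {f : BiframeHom L M}
    (hf : f.ProvidesBicompl) :
    ∀ s ∈ L.fin, f.main s ⊔ (f.main s)ᶜ = ⊤ := fun s hs => by
  refine sup_compl_of_mem_fin (fun a => ?_) (fun b => ?_) hs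
  · rw [f.main_posIncl]
    exact ⟨_, isCompl_bipseudoPos (hf.1 a)⟩
  · rw [f.main_negIncl]
    exact ⟨_, (isCompl_bipseudoNeg (hf.2 b)).symm⟩

/-- The extension of `f.main` to the finitary assembly restricts to the positive and the negative
component, because complements of negative elements are positive and vice versa. -/
theorem exists_assembly_extension {M : Biframe.{v}} (f : BiframeHom L M)
    (hf : f.ProvidesBicompl) : ∃ g : BiframeHom L.assembly M,
      g.comp L.toAssembly = f ∧ g.main = finExt f.main (sup_compl_of_providesBicompl hf) := by
  set k := finExt f.main (sup_compl_of_providesBicompl hf)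
  have hkn : ∀ x, k (L.toAssembly.main x) = f.main x := finExt_nabla _
  have hp : ∀ P, ∃ a, M.posIncl a = k.comp L.assembly.posIncl P := by
    refine assembly_pos_induction (fun a => ?_) (fun b => ?_) (FrameHom.exists_map_eq_top _ _)
      (fun _ _ => FrameHom.exists_map_eq_inf) (fun _ => FrameHom.exists_map_eq_sSup)
    · exact ⟨f.pos a, ((hkn _).trans (f.main_posIncl a)).symm⟩
    · have h1 := (isCompl_deltaNeg b).map k
      have h2 : k (L.assembly.negIncl (L.toAssembly.neg b)) = M.negIncl (f.neg b) :=
        (hkn _).trans (f.main_negIncl b)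
      rw [h2] at h1
      exact ⟨_, (isCompl_bipseudoNeg (hf.2 b)).left_unique h1⟩
  have hn : ∀ N, ∃ b, M.negIncl b = k.comp L.assembly.negIncl N := by
    refine assembly_neg_induction (fun b => ?_) (fun a => ?_) (FrameHom.exists_map_eq_top _ _)
      (fun _ _ => FrameHom.exists_map_eq_inf) (fun _ => FrameHom.exists_map_eq_sSup)
    · exact ⟨f.neg b, ((hkn _).trans (f.main_negIncl b)).symm⟩
    · have h1 := (isCompl_deltaPos a).map k
      have h2 : k (L.assembly.posIncl (L.toAssembly.pos a)) = M.posIncl (f.pos a) :=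
        (hkn _).trans (f.main_posIncl a)
      rw [h2] at h1
      exact ⟨_, (isCompl_bipseudoPos (hf.1 a)).right_unique h1⟩
  obtain ⟨kp, hkp⟩ := FrameHom.exists_factor_of_injective M.posIncl_injective
    (k.comp L.assembly.posIncl) hp
  obtain ⟨kn, hkn'⟩ := FrameHom.exists_factor_of_injective M.negIncl_injective
    (k.comp L.assembly.negIncl) hn
  refine ⟨⟨kp, kn, k, fun a => (hkp a).symm, fun b => (hkn' b).symm⟩, ?_, rfl⟩
  refine BiframeHom.ext_pair ?_ ?_
  · ext a
    exact M.posIncl_injective ((hkp _).trans ((hkn _).trans (f.main_posIncl a)))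
  · ext b
    exact M.negIncl_injective ((hkn' _).trans ((hkn _).trans (f.main_negIncl b)))

/-! ### The assembly is finitary -/

/-- A finitary biframe is presented by relations `R` between finitary elements of `L⁺ ⊕ L⁻`: these
hold in `L`, and frame maps out of `L` are pairs of frame maps out of `L⁺` and `L⁻` respecting
them. -/
theorem IsFinitary.exists_presentation (hL : L.IsFinitary) :
    ∃ R : FrameCoprod L.pos L.neg → FrameCoprod L.pos L.neg → Prop,
      (∀ x y, R x y → x ∈ finElts FrameCoprod.inl FrameCoprod.inr ∧
        y ∈ finElts FrameCoprod.inl FrameCoprod.inr) ∧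
      (∀ x y, R x y → FrameCoprod.copair L.posIncl L.negIncl x ≤
        FrameCoprod.copair L.posIncl L.negIncl y) ∧
      ∀ (M : Type w) [Order.Frame M] (f : FrameHom L.pos M) (g : FrameHom L.neg M),
        (∀ x y, R x y → FrameCoprod.copair f g x ≤ FrameCoprod.copair f g y) →
          ∃ h : FrameHom L.main M, (∀ a, h (L.posIncl a) = f a) ∧ ∀ b, h (L.negIncl b) = g b := by
  obtain ⟨_, ⟨R, hR, rfl⟩, i, hip, hin⟩ := hL
  refine ⟨R, hR, fun x y hxy => ?_, fun M _ f g hfg => ?_⟩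
  · let iF : FrameHom (gen R).Quo L.main :=
      { toFun := i
        map_inf' := map_inf i
        map_top' := map_top i
        map_sSup' := map_sSup i }
    have e : FrameCoprod.copair L.posIncl L.negIncl = iF.comp (gen R).proj :=
      FrameCoprod.hom_ext (fun a => (FrameCoprod.copair_inl _ _ a).trans (hip a).symm)
        (fun b => (FrameCoprod.copair_inr _ _ b).trans (hin b).symm)
    rw [e]
    exact OrderHomClass.mono iF ((gen R).proj_le_proj.2 (gen_rel hxy))
  · let iS : FrameHom L.main (gen R).Quo :=
      { toFun := i.symm
        map_inf' := map_inf i.symm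
        map_top' := map_top i.symm
        map_sSup' := map_sSup i.symm }
    have hk : gen R ≤ ker (FrameCoprod.copair f g) := gen_le fun x y hxy => by
      change FrameCoprod.copair f g (x ⊔ y) = FrameCoprod.copair f g y
      rw [map_sup, sup_eq_right]
      exact hfg x y hxy
    refine ⟨((gen R).lift (FrameCoprod.copair f g) hk).comp iS, fun a => ?_, fun b => ?_⟩
    · change (gen R).lift _ hk (i.symm (L.posIncl a)) = _
      rw [← hip, i.symm_apply_apply]
      exact FrameCoprod.copair_inl f g a
    · change (gen R).lift _ hk (i.symm (L.negIncl b)) = _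
      rw [← hin, i.symm_apply_apply]
      exact FrameCoprod.copair_inr f g b

/-- The relations between finitary elements of `A(L)⁺ ⊕ A(L)⁻` that present the assembly of a
biframe presented by the relations `R`: the images of the relations `R` under `∇`, and relations
saying that `∇ a` and `Δ a` are complements, for positive and for negative elements `a`. -/
inductive AssemblyRel (R : FrameCoprod L.pos L.neg → FrameCoprod L.pos L.neg → Prop) :
    FrameCoprod L.assembly.pos L.assembly.neg → FrameCoprod L.assembly.pos L.assembly.neg → Prop
  | nabla {x y} (h : R x y) : AssemblyRel R
      (FrameCoprod.copair (FrameCoprod.inl.comp L.toAssembly.pos)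
        (FrameCoprod.inr.comp L.toAssembly.neg) x)
      (FrameCoprod.copair (FrameCoprod.inl.comp L.toAssembly.pos)
        (FrameCoprod.inr.comp L.toAssembly.neg) y)
  | pos_inf (a : L.pos) : AssemblyRel R
      (FrameCoprod.inl (L.toAssembly.pos a) ⊓ FrameCoprod.inr (deltaPos a)) ⊥
  | pos_sup (a : L.pos) : AssemblyRel R ⊤
      (FrameCoprod.inl (L.toAssembly.pos a) ⊔ FrameCoprod.inr (deltaPos a))
  | neg_inf (b : L.neg) : AssemblyRel R
      (FrameCoprod.inl (deltaNeg b) ⊓ FrameCoprod.inr (L.toAssembly.neg b)) ⊥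
  | neg_sup (b : L.neg) : AssemblyRel R ⊤
      (FrameCoprod.inl (deltaNeg b) ⊔ FrameCoprod.inr (L.toAssembly.neg b))

theorem AssemblyRel.mem_finElts
    {R : FrameCoprod L.pos L.neg → FrameCoprod L.pos L.neg → Prop}
    (hR : ∀ x y, R x y → x ∈ finElts FrameCoprod.inl FrameCoprod.inr ∧
      y ∈ finElts FrameCoprod.inl FrameCoprod.inr)
    {x y : FrameCoprod L.assembly.pos L.assembly.neg} (h : AssemblyRel R x y) :
    x ∈ finElts FrameCoprod.inl FrameCoprod.inr ∧
      y ∈ finElts FrameCoprod.inl FrameCoprod.inr := by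
  have key : ∀ x ∈ finElts (FrameCoprod.inl (A := L.pos) (B := L.neg)) FrameCoprod.inr,
      FrameCoprod.copair (FrameCoprod.inl.comp L.toAssembly.pos)
        (FrameCoprod.inr.comp L.toAssembly.neg) x ∈
      finElts (FrameCoprod.inl (A := L.assembly.pos) (B := L.assembly.neg)) FrameCoprod.inr := by
    intro x hx
    obtain ⟨s, rfl⟩ := hx
    rw [map_finset_sup]
    refine Finset.sup_induction bot_mem_finElts (fun _ hx _ hy => sup_mem_finElts hx hy)
      fun p _ => ?_
    change FrameCoprod.copair _ _ (_ ⊓ _) ∈ _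
    rw [map_inf, FrameCoprod.copair_inl, FrameCoprod.copair_inr]
    exact map_inf_map_mem_finElts _ _
  cases h with
  | nabla h => exact ⟨key _ (hR _ _ h).1, key _ (hR _ _ h).2⟩
  | pos_inf a => exact ⟨map_inf_map_mem_finElts _ _, bot_mem_finElts⟩
  | pos_sup a =>
    exact ⟨top_mem_finElts, sup_mem_finElts (left_mem_finElts _) (right_mem_finElts _)⟩
  | neg_inf b => exact ⟨map_inf_map_mem_finElts _ _, bot_mem_finElts⟩
  | neg_sup b =>
    exact ⟨top_mem_finElts, sup_mem_finElts (left_mem_finElts _) (right_mem_finElts _)⟩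

/-- The frame presented by `AssemblyRel R` maps to the assembly by evaluation, and the inverse is
the extension of a frame map out of `L` given by the universal property of the assembly. -/
theorem assembly_isFinitary (hL : L.IsFinitary) : L.assembly.IsFinitary := by
  obtain ⟨R, hR, hRL, hRM⟩ := hL.exists_presentation
  set C : FrameCon (FrameCoprod L.assembly.pos L.assembly.neg) := gen (AssemblyRel R)
  set k : FrameHom (FrameCoprod L.pos L.neg) (FrameCoprod L.assembly.pos L.assembly.neg) :=
    FrameCoprod.copair (FrameCoprod.inl.comp L.toAssembly.pos)
      (FrameCoprod.inr.comp L.toAssembly.neg)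
  have hkl : ∀ a, k (FrameCoprod.inl a) = FrameCoprod.inl (L.toAssembly.pos a) := fun a =>
    FrameCoprod.copair_inl _ _ a
  have hkr : ∀ b, k (FrameCoprod.inr b) = FrameCoprod.inr (L.toAssembly.neg b) := fun b =>
    FrameCoprod.copair_inr _ _ b
  have hle : ∀ {x y}, AssemblyRel R x y → C.proj x ≤ C.proj y := fun h =>
    C.proj_le_proj.2 (gen_rel h)
  -- `∇` induces a frame map `h` from `L` to the presented frame.
  obtain ⟨h, hhp, hhn⟩ := hRM C.Quo (C.proj.comp (FrameCoprod.inl.comp L.toAssembly.pos))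
    (C.proj.comp (FrameCoprod.inr.comp L.toAssembly.neg)) fun x y hxy => by
      have e : FrameCoprod.copair (C.proj.comp (FrameCoprod.inl.comp L.toAssembly.pos))
          (C.proj.comp (FrameCoprod.inr.comp L.toAssembly.neg)) = C.proj.comp k :=
        FrameCoprod.hom_ext
          (fun a => (FrameCoprod.copair_inl _ _ a).trans (congrArg C.proj (hkl a)).symm)
          (fun b => (FrameCoprod.copair_inr _ _ b).trans (congrArg C.proj (hkr b)).symm)
      rw [e]
      exact hle (AssemblyRel.nabla hxy)
  have hcp : ∀ a, IsCompl (C.proj (FrameCoprod.inl (L.toAssembly.pos a)))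
      (C.proj (FrameCoprod.inr (deltaPos a))) := fun a => by
    refine ⟨disjoint_iff_inf_le.2 ?_, codisjoint_iff_le_sup.2 ?_⟩
    · rw [← map_inf, ← map_bot C.proj]
      exact hle (AssemblyRel.pos_inf a)
    · rw [← map_sup, ← map_top C.proj]
      exact hle (AssemblyRel.pos_sup a)
  have hcn : ∀ b, IsCompl (C.proj (FrameCoprod.inl (deltaNeg b)))
      (C.proj (FrameCoprod.inr (L.toAssembly.neg b))) := fun b => by
    refine ⟨disjoint_iff_inf_le.2 ?_, codisjoint_iff_le_sup.2 ?_⟩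
    · rw [← map_inf, ← map_bot C.proj]
      exact hle (AssemblyRel.neg_inf b)
    · rw [← map_sup, ← map_top C.proj]
      exact hle (AssemblyRel.neg_sup b)
  have hcompl : ∀ s ∈ L.fin, h s ⊔ (h s)ᶜ = ⊤ := fun s hs =>
    sup_compl_of_mem_fin (fun a => ⟨_, (hhp a).symm ▸ hcp a⟩)
      (fun b => ⟨_, (hhn b).symm ▸ (hcn b).symm⟩) hs
  -- `u` and `d` are the mutually inverse maps between the assembly and the presented frame.
  let d : FrameHom L.assembly.main C.Quo := finExt h hcompl
  have hd : ∀ x, d (L.toAssembly.main x) = h x := finExt_nabla hcompl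
  let u₀ : FrameHom (FrameCoprod L.assembly.pos L.assembly.neg) L.assembly.main :=
    FrameCoprod.copair L.assembly.posIncl L.assembly.negIncl
  have hu₀l : ∀ P, u₀ (FrameCoprod.inl P) = L.assembly.posIncl P := FrameCoprod.copair_inl _ _
  have hu₀r : ∀ N, u₀ (FrameCoprod.inr N) = L.assembly.negIncl N := FrameCoprod.copair_inr _ _
  have hu₀k : u₀.comp k = L.toAssembly.main.comp (FrameCoprod.copair L.posIncl L.negIncl) := by
    refine FrameCoprod.hom_ext (fun a => ?_) (fun b => ?_)
    · change u₀ (k _) = L.toAssembly.main (FrameCoprod.copair _ _ _)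
      rw [hkl, hu₀l, FrameCoprod.copair_inl]
      rfl
    · change u₀ (k _) = L.toAssembly.main (FrameCoprod.copair _ _ _)
      rw [hkr, hu₀r, FrameCoprod.copair_inr]
      rfl
  have hu₀ : ∀ x y, AssemblyRel R x y → u₀ x ≤ u₀ y := by
    intro x y hxy
    cases hxy with
    | @nabla x y hxy =>
      change u₀.comp k x ≤ u₀.comp k y
      rw [hu₀k]
      exact OrderHomClass.mono L.toAssembly.main (hRL x y hxy)
    | pos_inf a =>
      rw [map_inf, map_bot, hu₀l, hu₀r]
      exact (isCompl_deltaPos a).inf_eq_bot.le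
    | pos_sup a =>
      rw [map_sup, map_top, hu₀l, hu₀r]
      exact (isCompl_deltaPos a).sup_eq_top.ge
    | neg_inf b =>
      rw [map_inf, map_bot, hu₀l, hu₀r]
      exact (isCompl_deltaNeg b).inf_eq_bot.le
    | neg_sup b =>
      rw [map_sup, map_top, hu₀l, hu₀r]
      exact (isCompl_deltaNeg b).sup_eq_top.ge
  let u : FrameHom C.Quo L.assembly.main := C.lift u₀
    (gen_le (C := ker u₀) fun x y hxy => by
      change u₀ (x ⊔ y) = u₀ y
      rw [map_sup, sup_eq_right]
      exact hu₀ x y hxy)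
  have hdp : ∀ P, d (L.assembly.posIncl P) = C.proj (FrameCoprod.inl P) := by
    have : d.comp L.assembly.posIncl = C.proj.comp FrameCoprod.inl := by
      refine assembly_pos_hom_ext (fun a => ?_) (fun b => ?_)
      · exact (hd _).trans (hhp a)
      · have h1 := (isCompl_deltaNeg b).map d
        have h2 : d (L.assembly.negIncl (L.toAssembly.neg b)) = _ := (hd _).trans (hhn b)
        rw [h2] at h1
        exact h1.left_unique (hcn b)
    exact fun P => congrArg (fun g : FrameHom L.assembly.pos C.Quo => g P) this
  have hdn : ∀ N, d (L.assembly.negIncl N) = C.proj (FrameCoprod.inr N) := by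
    have : d.comp L.assembly.negIncl = C.proj.comp FrameCoprod.inr := by
      refine assembly_neg_hom_ext (fun b => ?_) (fun a => ?_)
      · exact (hd _).trans (hhn b)
      · have h1 := (isCompl_deltaPos a).map d
        have h2 : d (L.assembly.posIncl (L.toAssembly.pos a)) = _ := (hd _).trans (hhp a)
        rw [h2] at h1
        exact h1.right_unique (hcp a)
    exact fun P => congrArg (fun g : FrameHom L.assembly.neg C.Quo => g P) this
  have hdu : ∀ q, d (u q) = q := by
    intro q
    obtain ⟨x, rfl⟩ := C.proj_surjective q
    have : d.comp u₀ = C.proj := FrameCoprod.hom_ext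
      (fun P => (congrArg d (hu₀l P)).trans (hdp P)) (fun N => (congrArg d (hu₀r N)).trans (hdn N))
    exact congrArg (fun g : FrameHom _ C.Quo => g x) this
  have hud : ∀ D, u (d D) = D := by
    have h1 : (u.comp d).comp L.toAssembly.main = L.toAssembly.main := by
      refine main_hom_ext (fun a => ?_) (fun b => ?_)
      · change u (d (L.toAssembly.main _)) = _
        rw [hd, hhp]
        exact hu₀l _
      · change u (d (L.toAssembly.main _)) = _
        rw [hd, hhn]
        exact hu₀r _
    have h2 : u.comp d = FrameHom.id _ := assembly_main_hom_ext fun x =>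
      congrArg (fun g : FrameHom L.main L.assembly.main => g x) h1
    exact fun D => congrArg (fun g : FrameHom L.assembly.main L.assembly.main => g D) h2
  refine ⟨C, ⟨AssemblyRel R, fun x y hxy => hxy.mem_finElts hR, rfl⟩,
    { toFun := u, invFun := d, left_inv := hdu, right_inv := hud, map_rel_iff' := ?_ },
    hu₀l, hu₀r⟩
  intro p q
  refine ⟨fun hpq => ?_, fun hpq => OrderHomClass.mono u hpq⟩
  rw [← hdu p, ← hdu q]
  exact OrderHomClass.mono d hpq

/-! ### Biquotients -/

/-- The finitary assembly is anti-isomorphic to the collection of biquotients. -/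
def assemblyIsoBiquot (L : Biframe.{u}) : L.assembly.main ≃o L.Biquotᵒᵈ where
  toFun C := OrderDual.toDual ⟨⟨L.quot C.1, L.quotMap C.1⟩, C.1, mem_finAssembly_iff.1 C.2, rfl⟩
  invFun Q := ⟨(OrderDual.ofDual Q).con, by
    obtain ⟨_, C, hC, rfl⟩ := Q
    change ker C.proj ∈ _
    rw [ker_proj]
    exact mem_finAssembly_iff.2 hC⟩
  left_inv C := Subtype.ext C.1.ker_proj
  right_inv Q := congrArg OrderDual.toDual (Subtype.ext (Biquot.val_eq (OrderDual.ofDual Q)).symm)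
  map_rel_iff' {C D} := by
    change ker C.1.proj ≤ ker D.1.proj ↔ C.1 ≤ D.1
    rw [ker_proj, ker_proj]

/-- A partial order that is isomorphic to a coframe is a coframe. -/
theorem exists_coframe_of_orderIso {α : Type u} {β : Type v} [P : PartialOrder α]
    [Order.Coframe β] (e : β ≃o α) : ∃ c : Order.Coframe α, c.toPartialOrder = P := by
  let _ : CompleteLattice α := e.toGaloisInsertion.liftCompleteLattice
  refine ⟨Order.Coframe.ofMinimalAxioms ⟨fun a s => ?_⟩, rfl⟩
  refine e.symm.le_iff_le.1 ?_
  simp only [map_iInf, map_sup, map_sInf, sInf_image, sup_iInf₂_eq, le_refl]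

end Biframe

/-! ### Points and the Skula bispace -/

namespace Biframe

open FrameCon

theorem point_sSup_iff {A : Type u} [Order.Frame A] (f : FrameHom A Prop) (S : Set A) :
    f (sSup S) ↔ ∃ a ∈ S, f a := by
  rw [map_sSup]
  exact ⟨fun ⟨_, ⟨a, ha, e⟩, h⟩ => ⟨a, ha, e.mpr h⟩, fun ⟨a, ha, h⟩ => ⟨_, ⟨a, ha, rfl⟩, h⟩⟩

theorem point_inf_iff {A : Type u} [Order.Frame A] (f : FrameHom A Prop) (a b : A) :
    f (a ⊓ b) ↔ f a ∧ f b := iff_of_eq (map_inf f a b)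

theorem point_sup_iff {A : Type u} [Order.Frame A] (f : FrameHom A Prop) (a b : A) :
    f (a ⊔ b) ↔ f a ∨ f b := iff_of_eq (map_sup f a b)

theorem point_main_posIncl_iff {N : Biframe.{u}} (f : BiframeHom N two) (a : N.pos) :
    (f.main (N.posIncl a) : Prop) ↔ (f.pos a : Prop) := iff_of_eq (f.main_posIncl a)

theorem point_main_negIncl_iff {N : Biframe.{u}} (f : BiframeHom N two) (b : N.neg) :
    (f.main (N.negIncl b) : Prop) ↔ (f.neg b : Prop) := iff_of_eq (f.main_negIncl b)

theorem isCompl_not (p : Prop) : IsCompl p ¬ p := isCompl_compl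

theorem providesBicompl_two {L : Biframe.{u}} (f : BiframeHom L two) : f.ProvidesBicompl :=
  ⟨fun a => hasBicomplPos_of_isCompl (M := two) (y := (¬ f.pos a : Prop)) (isCompl_not _),
    fun b => hasBicomplNeg_of_isCompl (M := two) (x := (¬ f.neg b : Prop)) (isCompl_not _).symm⟩

/-- The bijection between the points of a biframe and the points of its assembly; it extends a
point along `∇`, which is possible because all elements of `2` have bicomplements. -/
noncomputable def pointEquiv (L : Biframe.{u}) :
    L.bpt.skula.carrier ≃ L.assembly.bpt.carrier where
  toFun f := (exists_assembly_extension f (providesBicompl_two f)).choose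
  invFun g := BiframeHom.comp g L.toAssembly
  left_inv f := (exists_assembly_extension f (providesBicompl_two f)).choose_spec.1
  right_inv g := assembly_hom_ext (exists_assembly_extension _
    (providesBicompl_two (BiframeHom.comp g L.toAssembly))).choose_spec.1

variable {L : Biframe.{u}}

theorem pointEquiv_comp (f : BiframeHom L two) :
    BiframeHom.comp (L.pointEquiv f) L.toAssembly = f := L.pointEquiv.symm_apply_apply f

theorem pointEquiv_main (f : BiframeHom L two) :
    BiframeHom.main (L.pointEquiv f) =
      finExt f.main (sup_compl_of_providesBicompl (providesBicompl_two f)) :=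
  (exists_assembly_extension f (providesBicompl_two f)).choose_spec.2

/-- A point of the assembly is false at a finitary congruence `C` exactly if the corresponding
point of the biframe factors through the quotient by `C`. -/
theorem not_pointEquiv_main_iff (f : BiframeHom L two) (C : L.assembly.main) :
    ¬ (BiframeHom.main (L.pointEquiv f) C : Prop) ↔ C.1 ≤ ker f.main := by
  rw [← comap_nabla_bot, ← finExt_le_iff (sup_compl_of_providesBicompl (providesBicompl_two f)),
    ← pointEquiv_main]
  exact Iff.rfl

theorem point_pos_deltaNeg (g : BiframeHom L.assembly two) (b : L.neg) :
    (g.pos (deltaNeg b) : Prop) ↔ ¬ (g.neg (L.toAssembly.neg b) : Prop) := by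
  have h := (isCompl_deltaNeg b).map g.main
  rw [g.main_posIncl, g.main_negIncl] at h
  exact iff_of_eq (h.left_unique (isCompl_not _).symm)

theorem point_neg_deltaPos (g : BiframeHom L.assembly two) (a : L.pos) :
    (g.neg (deltaPos a) : Prop) ↔ ¬ (g.pos (L.toAssembly.pos a) : Prop) := by
  have h := (isCompl_deltaPos a).map g.main
  rw [g.main_posIncl, g.main_negIncl] at h
  exact iff_of_eq (h.right_unique (isCompl_not _))

theorem continuous_pointEquiv_pos :
    @Continuous _ _ L.bpt.skula.pos L.assembly.bpt.pos L.pointEquiv := by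
  let _ := L.bpt.skula.pos
  let _ := L.assembly.bpt.pos
  refine continuous_def.2 ?_
  rintro _ ⟨P, rfl⟩
  refine assembly_pos_induction (p := fun P => IsOpen (L.pointEquiv ⁻¹' L.assembly.posPoints P))
    (fun a => ?_) (fun b => ?_) ?_ (fun P Q hP hQ => ?_) (fun S hS => ?_) P
  · refine TopologicalSpace.isOpen_generateFrom_of_mem (Or.inl ⟨a, Set.ext fun f => ?_⟩)
    exact iff_of_eq (congrArg (fun f : BiframeHom L two => f.pos a) (pointEquiv_comp f))
  · refine TopologicalSpace.isOpen_generateFrom_of_mem (Or.inr ?_)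
    refine (@isOpen_compl_iff _ _ L.bpt.neg).1 ⟨b, Set.ext fun f => ?_⟩
    refine (not_congr (point_pos_deltaNeg _ b)).trans (not_not.trans ?_)
    exact iff_of_eq (congrArg (fun f : BiframeHom L two => f.neg b) (pointEquiv_comp f))
  · rw [map_top]
    exact isOpen_univ
  · rw [map_inf]
    exact hP.inter hQ
  · have e : L.pointEquiv ⁻¹' L.assembly.posPoints (sSup S) =
        ⋃ P ∈ S, L.pointEquiv ⁻¹' L.assembly.posPoints P := Set.ext fun f => by
      rw [Set.mem_iUnion₂]
      refine (point_sSup_iff (BiframeHom.pos (L.pointEquiv f)) S).trans ?_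
      exact exists_congr fun P => exists_prop.symm
    rw [e]
    exact isOpen_biUnion hS

theorem continuous_pointEquiv_neg :
    @Continuous _ _ L.bpt.skula.neg L.assembly.bpt.neg L.pointEquiv := by
  let _ := L.bpt.skula.neg
  let _ := L.assembly.bpt.neg
  refine continuous_def.2 ?_
  rintro _ ⟨P, rfl⟩
  refine assembly_neg_induction (p := fun P => IsOpen (L.pointEquiv ⁻¹' L.assembly.negPoints P))
    (fun b => ?_) (fun a => ?_) ?_ (fun P Q hP hQ => ?_) (fun S hS => ?_) P
  · refine TopologicalSpace.isOpen_generateFrom_of_mem (Or.inl ⟨b, Set.ext fun f => ?_⟩)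
    exact iff_of_eq (congrArg (fun f : BiframeHom L two => f.neg b) (pointEquiv_comp f))
  · refine TopologicalSpace.isOpen_generateFrom_of_mem (Or.inr ?_)
    refine (@isOpen_compl_iff _ _ L.bpt.pos).1 ⟨a, Set.ext fun f => ?_⟩
    refine (not_congr (point_neg_deltaPos _ a)).trans (not_not.trans ?_)
    exact iff_of_eq (congrArg (fun f : BiframeHom L two => f.pos a) (pointEquiv_comp f))
  · rw [map_top]
    exact isOpen_univ
  · rw [map_inf]
    exact hP.inter hQ
  · have e : L.pointEquiv ⁻¹' L.assembly.negPoints (sSup S) =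
        ⋃ P ∈ S, L.pointEquiv ⁻¹' L.assembly.negPoints P := Set.ext fun f => by
      rw [Set.mem_iUnion₂]
      refine (point_sSup_iff (BiframeHom.neg (L.pointEquiv f)) S).trans ?_
      exact exists_congr fun P => exists_prop.symm
    rw [e]
    exact isOpen_biUnion hS

theorem continuous_pointEquiv_symm_pos :
    @Continuous _ _ L.assembly.bpt.pos L.bpt.skula.pos L.pointEquiv.symm := by
  refine continuous_generateFrom_iff.2 ?_
  rintro F (⟨a, rfl⟩ | hF)
  · exact ⟨L.toAssembly.pos a, rfl⟩
  · obtain ⟨b, hb⟩ := hF.isOpen_compl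
    refine ⟨deltaNeg b, Set.ext fun g => ?_⟩
    refine Set.notMem_compl_iff.symm.trans ((not_congr (Set.ext_iff.1 hb _)).trans ?_)
    exact (point_pos_deltaNeg g b).symm

theorem continuous_pointEquiv_symm_neg :
    @Continuous _ _ L.assembly.bpt.neg L.bpt.skula.neg L.pointEquiv.symm := by
  refine continuous_generateFrom_iff.2 ?_
  rintro F (⟨b, rfl⟩ | hF)
  · exact ⟨L.toAssembly.neg b, rfl⟩
  · obtain ⟨a, ha⟩ := hF.isOpen_compl
    refine ⟨deltaPos a, Set.ext fun g => ?_⟩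
    refine Set.notMem_compl_iff.symm.trans ((not_congr (Set.ext_iff.1 ha _)).trans ?_)
    exact (point_neg_deltaPos g a).symm

theorem isBihomeo_pointEquiv (L : Biframe.{u}) :
    Bispace.IsBihomeo (X := L.bpt.skula) (Y := L.assembly.bpt) L.pointEquiv := by
  constructor
  · let _ := L.bpt.skula.pos
    let _ := L.assembly.bpt.pos
    exact (Homeomorph.mk L.pointEquiv continuous_pointEquiv_pos
      continuous_pointEquiv_symm_pos).isHomeomorph
  · let _ := L.bpt.skula.neg
    let _ := L.assembly.bpt.neg
    exact (Homeomorph.mk L.pointEquiv continuous_pointEquiv_neg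
      continuous_pointEquiv_symm_neg).isHomeomorph

/-! ### The patch topology of a bispectrum -/

/-- The patch-open sets of a bispectrum are those given by the elements of the main component. -/
theorem isOpen_patch_bpt_iff {N : Biframe.{u}} {U : Set (BiframeHom N two)} :
    N.bpt.patch.IsOpen U ↔ ∃ c : N.main, U = {g | (g.main c : Prop)} := by
  constructor
  · intro h
    induction h with
    | basic U hU =>
      rcases hU with ⟨a, rfl⟩ | ⟨b, rfl⟩
      · exact ⟨N.posIncl a, Set.ext fun g => (point_main_posIncl_iff g a).symm⟩
      · exact ⟨N.negIncl b, Set.ext fun g => (point_main_negIncl_iff g b).symm⟩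
    | univ => exact ⟨⊤, Set.ext fun g => iff_of_eq (map_top g.main).symm⟩
    | inter U V _ _ hU hV =>
      obtain ⟨c, rfl⟩ := hU
      obtain ⟨d, rfl⟩ := hV
      exact ⟨c ⊓ d, Set.ext fun g => (point_inf_iff g.main c d).symm⟩
    | sUnion S _ hS =>
      refine ⟨sSup {c | {g : BiframeHom N two | (g.main c : Prop)} ∈ S}, Set.ext fun g => ?_⟩
      refine Iff.trans ?_ (point_sSup_iff g.main _).symm
      constructor
      · rintro ⟨U, hU, hg⟩
        obtain ⟨c, rfl⟩ := hS U hU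
        exact ⟨c, hU, hg⟩
      · rintro ⟨c, hc, hg⟩
        exact ⟨_, hc, hg⟩
  · rintro ⟨c, rfl⟩
    obtain ⟨S, rfl⟩ := N.exists_eq_sSup c
    have e : {g : BiframeHom N two |
        (g.main (sSup ((fun p => N.posIncl p.1 ⊓ N.negIncl p.2) '' S)) : Prop)} =
        ⋃ p ∈ S, (N.posPoints p.1 ∩ N.negPoints p.2 : Set (BiframeHom N two)) := by
      ext g
      refine (point_sSup_iff g.main _).trans ?_
      rw [Set.exists_mem_image, Set.mem_iUnion₂]
      refine exists_congr fun p => (and_congr_right fun hp => ?_).trans exists_prop.symm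
      refine (point_inf_iff g.main _ _).trans ?_
      exact and_congr (point_main_posIncl_iff g p.1) (point_main_negIncl_iff g p.2)
    rw [e]
    let _ := N.bpt.patch
    refine isOpen_biUnion fun p hp => IsOpen.inter ?_ ?_
    · exact TopologicalSpace.isOpen_generateFrom_of_mem (Or.inl ⟨p.1, rfl⟩)
    · exact TopologicalSpace.isOpen_generateFrom_of_mem (Or.inr ⟨p.2, rfl⟩)

/-- The patch-closed sets of points of the assembly are the sets of those points of the biframe
that factor through a finitary congruence. -/
theorem isClosed_patch_image_iff {Y : Set (BiframeHom L two)} :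
    @IsClosed _ L.assembly.bpt.patch (L.pointEquiv '' Y) ↔
      ∃ C, L.IsFinitaryCon C ∧ ∀ f, f ∈ Y ↔ C ≤ ker f.main := by
  have hY : ∀ f, f ∈ Y ↔ L.pointEquiv f ∈ L.pointEquiv '' Y := fun f =>
    (L.pointEquiv.injective.mem_set_image).symm
  rw [← @isOpen_compl_iff _ _ L.assembly.bpt.patch]
  refine isOpen_patch_bpt_iff.trans ⟨?_, ?_⟩
  · rintro ⟨C, hC⟩
    refine ⟨C.1, mem_finAssembly_iff.1 C.2, fun f => ?_⟩
    rw [← not_pointEquiv_main_iff, hY, ← Set.notMem_compl_iff, hC]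
    exact Iff.rfl
  · rintro ⟨C, hC, h⟩
    refine ⟨(⟨C, mem_finAssembly_iff.2 hC⟩ : L.finAssembly), Set.ext fun g => ?_⟩
    obtain ⟨f, rfl⟩ := L.pointEquiv.surjective g
    refine (not_congr ((hY f).symm.trans (h f))).trans ?_
    exact not_iff_comm.1 (not_pointEquiv_main_iff f _)

end Biframe

/-! ### Bisober bispaces -/

namespace Bispace

theorem isBisober_iff_bijective {X : Bispace.{u}} : X.IsBisober ↔ Function.Bijective X.unit := by
  refine ⟨fun h => @IsHomeomorph.bijective _ _ X.pos X.finOpens.bpt.pos _ h.1, fun h => ⟨?_, ?_⟩⟩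
  · let _ := X.pos
    let _ := X.finOpens.bpt.pos
    refine ⟨continuous_def.2 ?_, fun U hU => ⟨⟨U, hU⟩, Set.ext fun q => ?_⟩, h⟩
    · rintro _ ⟨U, rfl⟩
      exact U.2
    · obtain ⟨x, rfl⟩ := h.2 q
      exact h.1.mem_set_image
  · let _ := X.neg
    let _ := X.finOpens.bpt.neg
    refine ⟨continuous_def.2 ?_, fun U hU => ⟨⟨U, hU⟩, Set.ext fun q => ?_⟩, h⟩
    · rintro _ ⟨U, rfl⟩
      exact U.2
    · obtain ⟨x, rfl⟩ := h.2 q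
      exact h.1.mem_set_image

/-- A point of the finitary biframe of opens respects the covering relations
`U⁺ ∩ U⁻ ⊆ V⁺ ∪ V⁻`. -/
theorem finOpens_point_rel {X : Bispace.{u}} (q : BiframeHom X.finOpens Biframe.two)
    {U V : X.OpensPos} {U' V' : X.OpensNeg}
    (h : X.posSet U ∩ X.negSet U' ⊆ X.posSet V ∪ X.negSet V')
    (hU : (q.pos U : Prop)) (hU' : (q.neg U' : Prop)) : (q.pos V : Prop) ∨ (q.neg V' : Prop) := by
  have h1 : X.finOpensCon.proj (FrameCoprod.inl U ⊓ FrameCoprod.inr U') ≤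
      X.finOpensCon.proj (FrameCoprod.inl V ⊔ FrameCoprod.inr V') :=
    X.finOpensCon.proj_le_proj.2 (FrameCon.gen_rel ⟨U, V, U', V', h, rfl, rfl⟩)
  have h2 : X.finOpens.posIncl U ⊓ X.finOpens.negIncl U' ≤
      X.finOpens.posIncl V ⊔ X.finOpens.negIncl V' := by
    rw [map_inf, map_sup] at h1
    exact h1
  have h3 := OrderHomClass.mono q.main h2
  refine ((Biframe.point_sup_iff q.main _ _).1 (h3 ((Biframe.point_inf_iff q.main _ _).2
    ⟨(Biframe.point_main_posIncl_iff q U).2 hU, (Biframe.point_main_negIncl_iff q U').2 hU'⟩))).imp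
    (Biframe.point_main_posIncl_iff q V).1 (Biframe.point_main_negIncl_iff q V').1

end Bispace

namespace Biframe

open FrameCon

variable {L : Biframe.{u}}

/-- The restriction of positive elements to opens of a bisubspace of the bispectrum. -/
def restrictPos (Y : Set L.bpt.carrier) : FrameHom L.pos (L.bpt.sub Y).OpensPos where
  toFun a := @TopologicalSpace.Opens.mk _ (L.bpt.sub Y).pos (Subtype.val ⁻¹' L.posPoints a)
    ⟨_, ⟨a, rfl⟩, rfl⟩
  map_inf' a b := SetLike.coe_injective (Set.ext fun y => point_inf_iff (BiframeHom.pos y.1) a b)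
  map_top' := SetLike.coe_injective
    (Set.ext fun y => iff_of_eq (map_top (BiframeHom.pos y.1)))
  map_sSup' S := SetLike.coe_injective (Set.ext fun y => by
    refine (point_sSup_iff (BiframeHom.pos y.1) S).trans
      (Iff.trans ?_ (@TopologicalSpace.Opens.mem_sSup _ (L.bpt.sub Y).pos _ y).symm)
    exact ⟨fun ⟨a, ha, h⟩ => ⟨_, ⟨a, ha, rfl⟩, h⟩,
      fun ⟨_, ⟨a, ha, e⟩, h⟩ => ⟨a, ha, by rwa [← e] at h⟩⟩)

/-- The restriction of negative elements to opens of a bisubspace of the bispectrum. -/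
def restrictNeg (Y : Set L.bpt.carrier) : FrameHom L.neg (L.bpt.sub Y).OpensNeg where
  toFun a := @TopologicalSpace.Opens.mk _ (L.bpt.sub Y).neg (Subtype.val ⁻¹' L.negPoints a)
    ⟨_, ⟨a, rfl⟩, rfl⟩
  map_inf' a b := SetLike.coe_injective (Set.ext fun y => point_inf_iff (BiframeHom.neg y.1) a b)
  map_top' := SetLike.coe_injective
    (Set.ext fun y => iff_of_eq (map_top (BiframeHom.neg y.1)))
  map_sSup' S := SetLike.coe_injective (Set.ext fun y => by
    refine (point_sSup_iff (BiframeHom.neg y.1) S).trans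
      (Iff.trans ?_ (@TopologicalSpace.Opens.mem_sSup _ (L.bpt.sub Y).neg _ y).symm)
    exact ⟨fun ⟨a, ha, h⟩ => ⟨_, ⟨a, ha, rfl⟩, h⟩,
      fun ⟨_, ⟨a, ha, e⟩, h⟩ => ⟨a, ha, by rwa [← e] at h⟩⟩)

theorem restrictPos_surjective (Y : Set L.bpt.carrier) : Function.Surjective (restrictPos Y) := by
  rintro ⟨_, _, ⟨a, rfl⟩, rfl⟩
  exact ⟨a, rfl⟩

theorem restrictNeg_surjective (Y : Set L.bpt.carrier) : Function.Surjective (restrictNeg Y) := by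
  rintro ⟨_, _, ⟨a, rfl⟩, rfl⟩
  exact ⟨a, rfl⟩

/-- A point is the image of a point `y` of a bisubspace as soon as it agrees with `y` on the
restrictions of the elements of the biframe. -/
theorem unit_eq_iff {Y : Set L.bpt.carrier} {y : Y}
    {q : BiframeHom (L.bpt.sub Y).finOpens two} :
    (L.bpt.sub Y).unit y = q ↔
      (∀ a, (BiframeHom.pos y.1 a : Prop) ↔ (q.pos (restrictPos Y a) : Prop)) ∧
        ∀ b, (BiframeHom.neg y.1 b : Prop) ↔ (q.neg (restrictNeg Y b) : Prop) := by
  constructor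
  · rintro rfl
    exact ⟨fun a => Iff.rfl, fun b => Iff.rfl⟩
  · rintro ⟨hp, hn⟩
    refine BiframeHom.ext_pair ?_ ?_
    · ext U
      obtain ⟨a, rfl⟩ := restrictPos_surjective Y U
      exact propext (hp a)
    · ext U
      obtain ⟨b, rfl⟩ := restrictNeg_surjective Y U
      exact propext (hn b)

/-- Bisubspaces of a bispectrum are `T₀`, so that bisobriety is a matter of surjectivity. -/
theorem isBisober_sub_iff {Y : Set L.bpt.carrier} :
    (L.bpt.sub Y).IsBisober ↔ ∀ q : BiframeHom (L.bpt.sub Y).finOpens two, ∃ y : Y,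
      (L.bpt.sub Y).unit y = q := by
  rw [Bispace.isBisober_iff_bijective]
  refine ⟨fun h => h.2, fun h => ⟨fun y z hyz => Subtype.ext (BiframeHom.ext_pair ?_ ?_), h⟩⟩
  · ext a
    exact propext ((unit_eq_iff.1 hyz).1 a)
  · ext b
    exact propext ((unit_eq_iff.1 hyz).2 b)

theorem point_finset_sup_iff {A B M : Type*} [Order.Frame A] [Order.Frame B] [Order.Frame M]
    (u : FrameHom A M) (v : FrameHom B M) (e : FrameHom M Prop) (s : Finset (A × B)) :
    e (s.sup fun p => u p.1 ⊓ v p.2) ↔ ∃ p ∈ s, e (u p.1) ∧ e (v p.2) := by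
  classical
  induction s using Finset.induction_on with
  | empty => simp [map_bot]
  | insert p s _ ih =>
    rw [Finset.sup_insert, Finset.exists_mem_insert, ← ih]
    refine (iff_of_eq (map_sup e _ _)).trans (or_congr_left ?_)
    exact iff_of_eq (map_inf e _ _)

/-- A point `q` of the finitary opens of `Y` respects every inclusion `⋃ᵢ aᵢ ∩ bᵢ ⊆ ⋃ⱼ cⱼ ∩ dⱼ`
of finite unions that holds in `Y`. Were all `cⱼ ∩ dⱼ` false at `q`, then collecting the `cⱼ` that
are false at `q`, and the `dⱼ` for all other `j`, would give an inclusion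
`aᵢ ∩ bᵢ ⊆ ⋃ cⱼ ∪ ⋃ dⱼ` with a false right-hand side, by distributivity. -/
theorem finite_union_transfer {Y : Set L.bpt.carrier}
    (q : BiframeHom (L.bpt.sub Y).finOpens two) (s t : Finset (L.pos × L.neg))
    (h : ∀ y : Y, (∃ p ∈ s, (BiframeHom.pos y.1 p.1 : Prop) ∧ (BiframeHom.neg y.1 p.2 : Prop)) →
      ∃ p ∈ t, (BiframeHom.pos y.1 p.1 : Prop) ∧ (BiframeHom.neg y.1 p.2 : Prop))
    (hs : ∃ p ∈ s, (q.pos (restrictPos Y p.1) : Prop) ∧ (q.neg (restrictNeg Y p.2) : Prop)) :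
    ∃ p ∈ t, (q.pos (restrictPos Y p.1) : Prop) ∧ (q.neg (restrictNeg Y p.2) : Prop) := by
  obtain ⟨p, hp, hqa, hqb⟩ := hs
  by_contra! ht
  let qp : FrameHom L.pos Prop := FrameHom.comp q.pos (restrictPos Y)
  let qn : FrameHom L.neg Prop := FrameHom.comp q.neg (restrictNeg Y)
  let V : L.pos := sSup {c | (∃ r ∈ t, r.1 = c) ∧ ¬ qp c}
  let V' : L.neg := sSup {d | ∃ r ∈ t, r.2 = d ∧ qp r.1}
  have hsub : (L.bpt.sub Y).posSet (restrictPos Y p.1) ∩ (L.bpt.sub Y).negSet (restrictNeg Y p.2) ⊆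
      (L.bpt.sub Y).posSet (restrictPos Y V) ∪ (L.bpt.sub Y).negSet (restrictNeg Y V') := by
    rintro y ⟨ha, hb⟩
    obtain ⟨r, hr, hc, hd⟩ := h y ⟨p, hp, ha, hb⟩
    by_cases hq : qp r.1
    · exact Or.inr ((point_sSup_iff (BiframeHom.neg y.1) _).2 ⟨r.2, ⟨r, hr, rfl, hq⟩, hd⟩)
    · exact Or.inl ((point_sSup_iff (BiframeHom.pos y.1) _).2 ⟨r.1, ⟨⟨r, hr, rfl⟩, hq⟩, hc⟩)
  rcases Bispace.finOpens_point_rel q hsub hqa hqb with hV | hV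
  · obtain ⟨c, ⟨-, hc⟩, hc'⟩ := (point_sSup_iff qp _).1 hV
    exact hc hc'
  · obtain ⟨d, ⟨r, hr, rfl, hq⟩, hd⟩ := (point_sSup_iff qn _).1 hV
    exact ht r hr hq hd

/-- The point `q` respects every inequality between finitary elements of a frame `M` under `L⁺` and
`L⁻` that holds at all points in `Y`. -/
theorem finElts_transfer {Y : Set L.bpt.carrier} (q : BiframeHom (L.bpt.sub Y).finOpens two)
    {M : Type*} [Order.Frame M] {u : FrameHom L.pos M} {v : FrameHom L.neg M}
    {e : FrameHom M Prop} (hu : ∀ a, e (u a) ↔ (q.pos (restrictPos Y a) : Prop))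
    (hv : ∀ b, e (v b) ↔ (q.neg (restrictNeg Y b) : Prop))
    {ε : Y → FrameHom M Prop} (hεu : ∀ y a, ε y (u a) ↔ (BiframeHom.pos y.1 a : Prop))
    (hεv : ∀ y b, ε y (v b) ↔ (BiframeHom.neg y.1 b : Prop)) {x z : M}
    (hx : x ∈ finElts u v) (hz : z ∈ finElts u v) (h : ∀ y, ε y x ≤ ε y z) : e x ≤ e z := by
  obtain ⟨s, rfl⟩ := hx
  obtain ⟨t, rfl⟩ := hz
  intro hex
  have := finite_union_transfer q s t (fun y hy => by
    have := h y ((point_finset_sup_iff u v (ε y) s).2 (by simpa only [hεu, hεv] using hy))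
    simpa only [hεu, hεv] using (point_finset_sup_iff u v (ε y) t).1 this)
    (by simpa only [hu, hv] using (point_finset_sup_iff u v e s).1 hex)
  exact (point_finset_sup_iff u v e t).2 (by simpa only [hu, hv] using this)

/-- The points that factor through a finitary congruence `C` form a bisober bispace: a point of the
finitary opens of `Y` restricts to `L⁺` and `L⁻`, respects the finitary relations that present `L`,
hence is a point of `L`, and respects the finitary relations that generate `C`. -/
theorem isBisober_of_isClosed (hL : L.IsFinitary) {Y : Set L.bpt.carrier}
    {C : FrameCon L.main} (hC : L.IsFinitaryCon C)
    (hY : ∀ f : BiframeHom L two, f ∈ Y ↔ C ≤ ker f.main) : (L.bpt.sub Y).IsBisober := by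
  refine isBisober_sub_iff.2 fun q => ?_
  obtain ⟨R, hR, hRL, hRM⟩ := hL.exists_presentation
  let qp : FrameHom L.pos Prop := FrameHom.comp q.pos (restrictPos Y)
  let qn : FrameHom L.neg Prop := FrameHom.comp q.neg (restrictNeg Y)
  obtain ⟨m, hmp, hmn⟩ := hRM Prop qp qn fun x z hxz =>
    finElts_transfer q (fun a => iff_of_eq (FrameCoprod.copair_inl qp qn a))
      (fun b => iff_of_eq (FrameCoprod.copair_inr qp qn b))
      (ε := fun y => FrameHom.comp (BiframeHom.main y.1)
        (FrameCoprod.copair L.posIncl L.negIncl))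
      (fun y a => by
        refine Iff.trans (iff_of_eq (congrArg (BiframeHom.main y.1)
          (FrameCoprod.copair_inl L.posIncl L.negIncl a))) (point_main_posIncl_iff y.1 a))
      (fun y b => by
        refine Iff.trans (iff_of_eq (congrArg (BiframeHom.main y.1)
          (FrameCoprod.copair_inr L.posIncl L.negIncl b))) (point_main_negIncl_iff y.1 b))
      (hR x z hxz).1 (hR x z hxz).2
      fun y => OrderHomClass.mono (BiframeHom.main y.1) (hRL x z hxz)
  let p : BiframeHom L two := ⟨qp, qn, m, hmp, hmn⟩
  have hp : p ∈ Y := by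
    rw [hY]
    refine isFinitary_iff.1 hC _ fun x hx z hz hxz => ?_
    have h : m x ≤ m z := finElts_transfer q (fun a => iff_of_eq (hmp a))
      (fun b => iff_of_eq (hmn b)) (ε := fun y => BiframeHom.main y.1)
      (fun y a => point_main_posIncl_iff y.1 a) (fun y b => point_main_negIncl_iff y.1 b) hx hz
      fun y => by
        have h1 : BiframeHom.main y.1 (x ⊔ z) = BiframeHom.main y.1 z :=
          (hY y.1).1 y.2 _ _ hxz
        rw [map_sup, sup_eq_right] at h1
        exact h1
    change m (x ⊔ z) = m z
    rw [map_sup, sup_eq_right]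
    exact h
  exact ⟨⟨p, hp⟩, unit_eq_iff.2 ⟨fun a => Iff.rfl, fun b => Iff.rfl⟩⟩

/-- The relation generating the congruence of a set `Y` of points: all pairs
`(a ⊓ b, c ⊔ d)` whose inclusion holds at all points in `Y`. -/
def pointRel (Y : Set (BiframeHom L two)) (x z : L.main) : Prop :=
  ∃ (a c : L.pos) (b d : L.neg),
    (∀ y ∈ Y, (y.pos a : Prop) ∧ (y.neg b : Prop) → (y.pos c : Prop) ∨ (y.neg d : Prop)) ∧
      x = L.posIncl a ⊓ L.negIncl b ∧ z = L.posIncl c ⊔ L.negIncl d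

theorem isFinitaryCon_gen_pointRel (Y : Set (BiframeHom L two)) :
    L.IsFinitaryCon (gen (pointRel Y)) := by
  refine ⟨pointRel Y, ?_, rfl⟩
  rintro _ _ ⟨a, c, b, d, -, rfl, rfl⟩
  exact ⟨map_inf_map_mem_finElts a b, sup_mem_finElts (left_mem_finElts c) (right_mem_finElts d)⟩

theorem gen_pointRel_le_ker_iff {Y : Set (BiframeHom L two)} {f : BiframeHom L two} :
    gen (pointRel Y) ≤ ker f.main ↔ ∀ (a c : L.pos) (b d : L.neg),
      (∀ y ∈ Y, (y.pos a : Prop) ∧ (y.neg b : Prop) → (y.pos c : Prop) ∨ (y.neg d : Prop)) →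
        (f.pos a : Prop) ∧ (f.neg b : Prop) → (f.pos c : Prop) ∨ (f.neg d : Prop) := by
  have key : ∀ (a c : L.pos) (b d : L.neg),
      (ker f.main).r (L.posIncl a ⊓ L.negIncl b ⊔ (L.posIncl c ⊔ L.negIncl d))
        (L.posIncl c ⊔ L.negIncl d) ↔
      ((f.pos a : Prop) ∧ (f.neg b : Prop) → (f.pos c : Prop) ∨ (f.neg d : Prop)) := by
    intro a c b d
    change f.main _ = f.main _ ↔ _
    rw [map_sup, sup_eq_right]
    refine imp_congr ((point_inf_iff f.main _ _).trans (and_congr ?_ ?_))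
      ((point_sup_iff f.main _ _).trans (or_congr ?_ ?_))
    exacts [point_main_posIncl_iff f a, point_main_negIncl_iff f b, point_main_posIncl_iff f c,
      point_main_negIncl_iff f d]
  rw [gen_le_iff]
  constructor
  · exact fun h a c b d hY => (key a c b d).1 (h _ _ ⟨a, c, b, d, hY, rfl, rfl⟩)
  · rintro h _ _ ⟨a, c, b, d, hY, rfl, rfl⟩
    exact (key a c b d).2 (h a c b d hY)

/-- A bisober set `Y` consists of the points that respect all inclusions `a ∩ b ⊆ c ∪ d` holding in
`Y`, since such a point induces a point of the finitary opens of `Y`. -/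
theorem mem_iff_of_isBisober {Y : Set (BiframeHom L two)}
    (hY : Bispace.IsBisober (L.bpt.sub Y)) (f : BiframeHom L two) :
    f ∈ Y ↔ gen (pointRel Y) ≤ ker f.main := by
  rw [gen_pointRel_le_ker_iff]
  refine ⟨fun hf a c b d h => h f hf, fun hf => ?_⟩
  -- The components of `f` factor through the restriction to `Y`: apply `hf` with `b = ⊤`, `d = ⊥`.
  have hpos : ∀ a c, restrictPos Y a = restrictPos Y c → f.pos a ≤ f.pos c :=
    fun a c e ha => by
      refine (hf a c ⊤ ⊥ (fun y hy hya => Or.inl ?_)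
        ⟨ha, (iff_of_eq (map_top f.neg)).2 trivial⟩).resolve_right
          fun h => (iff_of_eq (map_bot f.neg)).1 h
      exact (Set.ext_iff.1 (congrArg (fun U => (L.bpt.sub Y).posSet U) e) ⟨y, hy⟩).1 hya.1
  have hneg : ∀ b d, restrictNeg Y b = restrictNeg Y d → f.neg b ≤ f.neg d :=
    fun b d e hb => by
      refine (hf ⊤ ⊥ b d (fun y hy hyb => Or.inr ?_)
        ⟨(iff_of_eq (map_top f.pos)).2 trivial, hb⟩).resolve_left
          fun h => (iff_of_eq (map_bot f.pos)).1 h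
      exact (Set.ext_iff.1 (congrArg (fun U => (L.bpt.sub Y).negSet U) e) ⟨y, hy⟩).1 hyb.2
  obtain ⟨qp, hqp⟩ := FrameHom.exists_factor_of_surjective (M := Prop)
    (restrictPos_surjective Y) f.pos
    fun a c e => propext ⟨hpos a c e, hpos c a e.symm⟩
  obtain ⟨qn, hqn⟩ := FrameHom.exists_factor_of_surjective (M := Prop)
    (restrictNeg_surjective Y) f.neg
    fun b d e => propext ⟨hneg b d e, hneg d b e.symm⟩
  have hle : (L.bpt.sub Y).finOpensCon ≤ ker (FrameCoprod.copair qp qn) := by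
    refine gen_le ?_
    rintro _ _ ⟨U, V, U', V', h, rfl, rfl⟩
    obtain ⟨a, rfl⟩ := restrictPos_surjective Y U
    obtain ⟨c, rfl⟩ := restrictPos_surjective Y V
    obtain ⟨b, rfl⟩ := restrictNeg_surjective Y U'
    obtain ⟨d, rfl⟩ := restrictNeg_surjective Y V'
    have hl : ∀ a, FrameCoprod.copair qp qn (FrameCoprod.inl (restrictPos Y a)) ↔ f.pos a :=
      fun a => iff_of_eq ((FrameCoprod.copair_inl qp qn _).trans (hqp a))
    have hr : ∀ b, FrameCoprod.copair qp qn (FrameCoprod.inr (restrictNeg Y b)) ↔ f.neg b :=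
      fun b => iff_of_eq ((FrameCoprod.copair_inr qp qn _).trans (hqn b))
    change FrameCoprod.copair qp qn _ = FrameCoprod.copair qp qn _
    rw [map_sup, sup_eq_right]
    intro hab
    obtain ⟨ha, hb⟩ := (point_inf_iff (FrameCoprod.copair qp qn) _ _).1 hab
    refine (point_sup_iff (FrameCoprod.copair qp qn) _ _).2 ((hf a c b d (fun y hy hab => ?_)
      ⟨(hl a).1 ha, (hr b).1 hb⟩).imp (hl c).2 (hr d).2)
    exact h (a := ⟨y, hy⟩) hab
  let q : BiframeHom (L.bpt.sub Y).finOpens two :=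
    { pos := qp
      neg := qn
      main := (L.bpt.sub Y).finOpensCon.lift (FrameCoprod.copair qp qn) hle
      main_posIncl := FrameCoprod.copair_inl qp qn
      main_negIncl := FrameCoprod.copair_inr qp qn }
  obtain ⟨y, hy⟩ := isBisober_sub_iff.1 hY q
  obtain ⟨hyp, hyn⟩ := unit_eq_iff.1 hy
  have e : f = y.1 := BiframeHom.ext_pair
    (by
      ext a
      exact propext ((hyp a).trans (iff_of_eq (hqp a))).symm)
    (by
      ext b
      exact propext ((hyn b).trans (iff_of_eq (hqn b))).symm)
  rw [e]
  exact y.2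

end Biframe


theorem mainTheorem10 (L : Biframe.{u}) (hL : L.IsFinitary) :
    -- the assembly is a finitary biframe
    L.assembly.IsFinitary ∧
    -- it freely provides bicomplements to all elements of `L⁺ ∪ L⁻`
    (L.toAssembly.ProvidesBicompl ∧
      ∀ (M : Biframe.{v}) (f : BiframeHom L M), f.ProvidesBicompl →
        ∃! g : BiframeHom L.assembly M, g.comp L.toAssembly = f) ∧
    -- its main component consists of the finitary congruences
    (∀ C : FrameCon L.main, C ∈ L.finAssembly ↔ L.IsFinitaryCon C) ∧
    -- the biquotients form a coframe, anti-isomorphic to the main component via `C ↦ L / C`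
    (∃ c : Order.Coframe L.Biquot,
      c.toPartialOrder = (inferInstance : PartialOrder L.Biquot)) ∧
    (∃ φ : L.assembly.main ≃o L.Biquotᵒᵈ, ∀ C : L.finAssembly,
      (OrderDual.ofDual (φ C)).1 = ⟨L.quot C.1, L.quotMap C.1⟩) ∧
    -- the Skula bispace of the bispectrum is the bispectrum of the assembly, and the patch-closed
    -- sets of the latter are the bisober bisubspaces of the bispectrum
    ∃ α : L.bpt.skula.carrier ≃ L.assembly.bpt.carrier,
      Bispace.IsBihomeo (X := L.bpt.skula) (Y := L.assembly.bpt) α ∧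
      (∀ f : BiframeHom L Biframe.two, BiframeHom.comp (α f) L.toAssembly = f) ∧
      ∀ Y : Set L.bpt.carrier,
        @IsClosed _ L.assembly.bpt.patch (α '' Y) ↔ (L.bpt.sub Y).IsBisober := by
  have hcof : ∃ c : Order.Coframe L.Biquot,
      c.toPartialOrder = (inferInstance : PartialOrder L.Biquot) :=
    Biframe.exists_coframe_of_orderIso
      (L.assemblyIsoBiquot.dual.trans (OrderIso.dualDual L.Biquot).symm)
  refine ⟨Biframe.assembly_isFinitary hL, ⟨Biframe.toAssembly_providesBicompl, fun M f hf => ?_⟩,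
    fun C => Biframe.mem_finAssembly_iff, hcof, ⟨L.assemblyIsoBiquot, fun C => rfl⟩,
    L.pointEquiv, L.isBihomeo_pointEquiv, Biframe.pointEquiv_comp, fun Y => ?_⟩
  · obtain ⟨g, hg, -⟩ := Biframe.exists_assembly_extension f hf
    exact ⟨g, hg, fun g' hg' => Biframe.assembly_hom_ext (hg'.trans hg.symm)⟩
  · refine Biframe.isClosed_patch_image_iff.trans ⟨?_, fun hY => ?_⟩
    · rintro ⟨C, hC, h⟩
      exact Biframe.isBisober_of_isClosed hL hC h
    · exact ⟨_, Biframe.isFinitaryCon_gen_pointRel Y, Biframe.mem_iff_of_isBisober hY⟩
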